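/- A \emph{4-dimensional graph-manifold} is a closed oriented 4-manifold $M$ glued from finitely many blocks $M_v=\Phi_v\times T^2$, $v\in V$, where $\Phi_v$ is a compact connected oriented surface with nonempty boundary, different from the disc and the annulus. The boundary tori $T_w=\gamma_w\times T^2$ of the blocks ($\gamma_w$ a boundary circle of $\Phi_v$) are indexed by the directed edges $w$ of a graph with vertex set $V$; $\partial v$ is the set of directed edges starting at $v$, and $-w$ is the opposite of $w$. The gluing homeomorphisms $T_{-w}\to T_w$ are mutually inverse for $w$ and $-w$, reverse the boundary orientations, and do not identify the homotopy classes of the fiber tori. Let $L_w=H_1(T_w;\mathbb Z)\cong\mathbb Z^3$ have the basis $(z_w,f^1_w,f^2_w)$, where $z_w$ is the class of $\gamma_w$ with the boundary orientation and $f_w=f_v$ is a basis of the fiber group $F_w=F_v\cong\mathbb Z^2$; let $g_w=\begin{pmatrix}a_w&b_w\\c_w&d_w\end{pmatrix}$, with $a_w\in\mathbb Z$, be the matrix of the gluing isomorphism $L_{-w}\to L_w$, i.e. $(z_{-w},f_{-w})=(z_w,f_w)\,g_w$ after identifying $L_{-w}$ with $L_w$. Put $P_w=F_w\cap F_{-w}$,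 considered as a subgroup of $F_v$ if $w\in\partial v$. The \emph{type} of $v$ is the maximal number of edges in $\partial v$ with pairwise different $P_w\subset F_v$. The \emph{intersection number} $i_w\ge 1$ of an edge is the greatest common divisor of the entries of $b_w$. The \emph{secondary intersection number} of a vertex $v$ of type 2 is the index in $F_v$ of the subgroup generated by its two intersection lattices $P_w$, $w\in\partial v$. Now pass to real coefficients. Let $D_w:F_{-w}\to F_w$ be the linear map with matrix $d_w$ in the bases $f_{-w},f_w$, let $u_w=f^1_w\wedge f^2_w$, and let $u_{w\cap -w}$ be the generator of the lattice $F_w\cap F_{-w}$ that is positive for the intersection orientation: if $a\in F_w$ and $b\in F_{-w}$ satisfy $a\wedge u_{w\cap -w}=u_w$ and $b\wedge u_{w\cap -w}=u_{-w}$, then $(a,b,u_{w\cap -w})$ has the same orientation in $L_w$ as $(z_w,f^1_w,f^2_w)$. Let $Q_v\subset\bigoplus_{w\in\partial v}F_{-w}$ be the subspace of all $(q_{-w})_w$ for which there is $\alpha\in\mathbb R$ with $q_{-w}\wedge u_{w\cap -w}=\alpha\,u_{-w}$ for all $w\in\partial v$. The \emph{charge map} $K_v:Q_v\to F_v$ is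 the restriction of $\bigoplus_{w\in\partial v}\frac1{i_w}D_w$ to $Q_v$. If all vertices have type 2, let $J_{-w}\subset F_{-w}$, for $w$ from $v$ to $u$, be the line spanned by the intersection lattice of $u$ different from the one of the edge $w$; the \emph{subspace of intersection vectors} is $B_v=Q_v\cap\bigoplus_{w\in\partial v}J_{-w}$. The graph-manifold $M$ is \emph{orthogonal} if the fibrations $M_v\to\Phi_v$ have trivializations $M_v\cong\Phi_v\times S^1\times S^1$ such that, in the induced trivializations $T_w\cong S^1\times S^1\times S^1$ of the boundary tori, every gluing map $T_{-w}\to T_w$ is, up to homotopy, a permutation of the circle factors, possibly combined with reflections of factors, that does not match the boundary circles of the two base surfaces. \textbf{Theorem.} Let $M$ be a 4-dimensional graph-manifold all of whose blocks have type 2. Then $M$ is orthogonal if and only if the following three conditions hold: (1) the intersection number of every edge is $1$; (2) the secondary intersection number of every vertex is $1$; (3) for every vertex $v$, $B_v\subset\ker K_v$. -/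

import Mathlib

/-! ### Tori and the action of their self-maps on first homology -/

/-- The `n`-dimensional torus `(ℝ/ℤ)ⁿ`, a product of `n` circles. -/
abbrev Torus (n : ℕ) : Type := Fin n → UnitAddCircle

/-- `n` is the degree of the self-map `c` of the circle: a lift `F : ℝ → ℝ` of `c` satisfies
`F 1 - F 0 = n`. -/
def HasDegree (c : C(UnitAddCircle, UnitAddCircle)) (n : ℤ) : Prop :=
  ∃ F : C(ℝ, ℝ), (∀ x : ℝ, ((F x : ℝ) : UnitAddCircle) = c (x : UnitAddCircle)) ∧ F 1 - F 0 = n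

theorem existsUnique_hasDegree (c : C(UnitAddCircle, UnitAddCircle)) :
    ∃! n : ℤ, HasDegree c n := by
  have cov : IsCoveringMap ((↑) : ℝ → UnitAddCircle) := AddCircle.isCoveringMap_coe 1
  let f : C(ℝ, UnitAddCircle) := c.comp ⟨((↑) : ℝ → UnitAddCircle), AddCircle.continuous_mk' 1⟩
  obtain ⟨e, he⟩ := QuotientAddGroup.mk_surjective (f 0)
  obtain ⟨F, ⟨hF0, hF⟩, -⟩ := cov.existsUnique_continuousMap_lifts f 0 e he
  have hF' : ∀ x : ℝ, ((F x : ℝ) : UnitAddCircle) = c (x : UnitAddCircle) := fun x => congrFun hF x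
  have h1 : ((1 : ℝ) : UnitAddCircle) = ((0 : ℝ) : UnitAddCircle) := by
    simp [AddCircle.coe_period]
  have h2 : ((F 1 - F 0 : ℝ) : UnitAddCircle) = 0 := by
    rw [AddCircle.coe_sub, hF', hF', h1, sub_self]
  obtain ⟨n, hn⟩ := (AddCircle.coe_eq_zero_iff 1).1 h2
  refine ⟨n, ⟨F, hF', by simpa using hn.symm⟩, ?_⟩
  rintro m ⟨G, hG, hm⟩
  obtain ⟨k, hk⟩ : ∃ k : ℤ, k • (1 : ℝ) = G 0 - F 0 := by
    refine (AddCircle.coe_eq_zero_iff 1).1 ?_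
    rw [AddCircle.coe_sub, hF', hG, sub_self]
  obtain ⟨H, -, hH⟩ := cov.existsUnique_continuousMap_lifts f 0 (G 0) (hG 0)
  have e1 := hH G ⟨rfl, funext hG⟩
  have e2 := hH ⟨fun x => F x + k, by fun_prop⟩ ⟨by simp at hk; simp; linarith, by
    funext x
    have : ((k : ℝ) : UnitAddCircle) = 0 := (AddCircle.coe_eq_zero_iff 1).2 ⟨k, by simp⟩
    change ((F x + k : ℝ) : UnitAddCircle) = c (x : UnitAddCircle)
    rw [AddCircle.coe_add, this, add_zero, hF']⟩
  have e3 : ∀ x, G x = F x + k := fun x => by rw [e1, ← e2]; rfl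
  have : (m : ℝ) = n := by
    rw [← hm, e3, e3]
    simp at hn
    linarith
  exact_mod_cast this

/-- The degree of a continuous self-map of the circle. -/
noncomputable def degree (c : C(UnitAddCircle, UnitAddCircle)) : ℤ :=
  (existsUnique_hasDegree c).choose

/-- The `j`-th coordinate circle of a torus; the homology classes of these circles form the
standard basis of `H₁(Torus n; ℤ) = ℤⁿ`. -/
def coordCircle {n : ℕ} (j : Fin n) : C(UnitAddCircle, Torus n) :=
  ⟨fun s => Function.update 0 j s, continuous_const.update j continuous_id⟩

/-- The `i`-th coordinate of a torus. -/
def coord {n : ℕ} (i : Fin n) : C(Torus n, UnitAddCircle) :=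
  ⟨fun x => x i, continuous_apply i⟩

/-- The matrix, in the standard bases, of the homomorphism that a continuous map of tori induces on
`H₁( · ; ℤ)`. -/
noncomputable def h1Matrix {m n : ℕ} (f : C(Torus m, Torus n)) : Matrix (Fin n) (Fin m) ℤ :=
  Matrix.of fun i j => degree ((coord i).comp (f.comp (coordCircle j)))

/-- The self-map of the 3-torus that permutes the circle factors by `σ`, with reflections of
the factors prescribed by the signs `ε`. -/
def signedPerm (σ : Equiv.Perm (Fin 3)) (ε : Fin 3 → ℤˣ) : C(Torus 3, Torus 3) :=
  ⟨fun x i => (ε i : ℤ) • x (σ i), by fun_prop⟩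

/-! ### Compact oriented surfaces with boundary

The oriented surface of genus `g` with `k` boundary circles is the `(4g+3k)`-gon with boundary word
`∏ᵢ aᵢ bᵢ aᵢ⁻¹ bᵢ⁻¹ · ∏ⱼ dⱼ cⱼ dⱼ⁻¹`, where equally labelled sides are glued and the sides `cⱼ`
remain free. -/

/-- The polygon is realized as the closed unit disc. -/
abbrev Disc : Type := Metric.closedBall (0 : ℂ) 1

/-- The point with parameter `t` on the boundary of the disc, divided into `N` sides; the `j`-th
side (`j = 0, …, N-1`) consists of the parameters in `[j, j+1]`. -/
noncomputable def sidePoint (N : ℕ) (t : ℝ) : Disc :=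
  ⟨Complex.exp ((2 * Real.pi * t / N : ℝ) * Complex.I), by
    rw [mem_closedBall_zero_iff, Complex.norm_exp_ofReal_mul_I]⟩

/-- `SidesPaired g k i j`: the `j`-th side carries the inverse of the label of the `i`-th side. -/
inductive SidesPaired (g k : ℕ) : ℕ → ℕ → Prop
  | a (i : Fin g) : SidesPaired g k (4 * i) (4 * i + 2)
  | b (i : Fin g) : SidesPaired g k (4 * i + 1) (4 * i + 3)
  | d (i : Fin k) : SidesPaired g k (4 * g + 3 * i) (4 * g + 3 * i + 2)

/-- Paired sides are identified with reversal of their direction. -/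
inductive SideRel (g k : ℕ) : Disc → Disc → Prop
  | glue (i j : ℕ) (h : SidesPaired g k i j) (s : ℝ) (hs : s ∈ Set.Icc (0 : ℝ) 1) :
      SideRel g k (sidePoint (4 * g + 3 * k) (i + s)) (sidePoint (4 * g + 3 * k) (j + (1 - s)))

/-- The standard compact oriented surface of genus `g` with `k` boundary circles (with the quotient
topology). -/
abbrev StdSurface (g k : ℕ) : Type := Quot (SideRel g k)

/-- The `i`-th boundary circle of the standard surface (the loop `cᵢ`), traversed in the direction
of the boundary orientation. -/
noncomputable def StdSurface.boundary (g k : ℕ) (i : Fin k) (s : UnitAddCircle) : StdSurface g k :=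
  Quot.mk _ (sidePoint (4 * g + 3 * k) ((4 * g + 3 * i + 1 : ℕ) + (AddCircle.equivIco 1 0 s : ℝ)))

/-- `Φ` is a compact connected oriented surface with nonempty boundary, different from the disc and
from the annulus, and the `γ w` parametrize its boundary circles, each of them once and in the
direction of the boundary orientation. -/
def IsBaseSurface {Φ ι : Type} [TopologicalSpace Φ] (γ : ι → C(UnitAddCircle, Φ)) : Prop :=
  ∃ (g k : ℕ) (e : Fin k ≃ ι) (h : StdSurface g k ≃ₜ Φ),
    1 ≤ k ∧ (g, k) ≠ (0, 1) ∧ (g, k) ≠ (0, 2) ∧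
      ∀ i s, h (StdSurface.boundary g k i s) = γ (e i) s

/-! ### Graph-manifolds -/

/-- The inclusion of the fiber group `F_w = R²` into `L_w = R³`. The coordinates of `L_w` refer to
the basis `(z_w, f¹_w, f²_w)`: the boundary circle of the base and the two circles of the fiber. -/
def fiberIncl (R : Type) [CommRing R] : (Fin 2 → R) →ₗ[R] (Fin 3 → R) where
  toFun p := ![0, p 0, p 1]
  map_add' p q := by ext i; fin_cases i <;> simp
  map_smul' r p := by ext i; fin_cases i <;> simp

/-- The fiber group as a sublattice of `L_w = ℤ³`. -/
def fiberLattice : Submodule ℤ (Fin 3 → ℤ) := LinearMap.range (fiberIncl ℤ)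

/-- A closed oriented 4-dimensional graph-manifold, presented by its decomposition into blocks
`M_v = Φ_v × T²` and by the gluing maps between their boundary tori. -/
structure GraphManifold where
  /-- vertices of the graph -/
  V : Type
  /-- directed edges of the graph; they correspond to the boundary tori of the blocks -/
  W : Type
  [fintypeV : Fintype V]
  [fintypeW : Fintype W]
  /-- the initial vertex of a directed edge -/
  orig : W → V
  /-- the directed edge `-w` opposite to `w` -/
  rev : W → W
  rev_rev : ∀ w, rev (rev w) = w
  rev_ne : ∀ w, rev w ≠ w
  /-- the base surfaces of the blocks -/
  Φ : V → Type
  [topΦ : ∀ v, TopologicalSpace (Φ v)]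
  /-- the boundary circles of the base surfaces, one for each directed edge that starts at the
  vertex -/
  circle : ∀ v, {w // orig w = v} → C(UnitAddCircle, Φ v)
  isBaseSurface : ∀ v, IsBaseSurface (circle v)
  /-- The gluing map `T_{-w} → T_w`; the boundary torus `T_w` is the product of the boundary circle
  of `w` (coordinate `0`) and the fiber (coordinates `1` and `2`). -/
  glue : W → (Torus 3 ≃ₜ Torus 3)
  glue_rev : ∀ w, glue (rev w) = (glue w).symm
  /-- gluing maps reverse the boundary orientations -/
  det_glue : ∀ w, (h1Matrix (glue w : C(Torus 3, Torus 3))).det = -1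
  /-- gluing maps do not identify the homotopy classes of the fiber tori -/
  glue_fiber : ∀ w,
    fiberLattice.map (h1Matrix (glue w : C(Torus 3, Torus 3))).mulVecLin ≠ fiberLattice

namespace GraphManifold

attribute [instance] GraphManifold.fintypeV GraphManifold.fintypeW GraphManifold.topΦ

variable (M : GraphManifold)

/-- The block over the vertex `v`. -/
abbrev Block (v : M.V) : Type := M.Φ v × Torus 2

/-- The boundary torus `T_w` in the block over the initial vertex of `w`. -/
def torusIncl (w : M.W) : C(Torus 3, M.Block (M.orig w)) :=
  ⟨fun x => (M.circle (M.orig w) ⟨w, rfl⟩ (x 0), fun i => x i.succ), by fun_prop⟩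

/-- The identifications of boundary points of the blocks by the gluing maps. -/
inductive GlueRel : (Σ v, M.Block v) → (Σ v, M.Block v) → Prop
  | glue (w : M.W) (x : Torus 3) :
      GlueRel ⟨_, M.torusIncl (M.rev w) x⟩ ⟨_, M.torusIncl w (M.glue w x)⟩

/-- The underlying space of the graph-manifold, glued from its blocks. -/
abbrev Space : Type := Quot M.GlueRel

/-- The trivializations of the fibration `M_v → Φ_v`, relative to the given one: fiber-preserving
homeomorphisms `M_v → Φ_v × S¹ × S¹` over the identity of `Φ_v`. -/
def BlockTrivialization (v : M.V) : Type :=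
  {τ : M.Block v ≃ₜ M.Φ v × Torus 2 // ∀ p, (τ p).1 = p.1}

/-- The trivialization `T_w → S¹ × S¹ × S¹` of a boundary torus that is induced by a trivialization
of the block. -/
def torusTrivialization {M : GraphManifold} (w : M.W) (τ : M.BlockTrivialization (M.orig w)) :
    C(Torus 3, Torus 3) :=
  ⟨fun x => Fin.cons (x 0) (τ.1 (M.torusIncl w x)).2, by
    refine continuous_pi fun i => ?_
    refine Fin.cases ?_ (fun j => ?_) i
    · simpa using continuous_apply 0
    · simp only [Fin.cons_succ]
      exact (continuous_apply j).comp
        (continuous_snd.comp (τ.1.continuous.comp (M.torusIncl w).continuous))⟩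

/-- A graph-manifold is orthogonal if its blocks have trivializations in which, up to homotopy,
every gluing map `T_{-w} → T_w` is a permutation of the circle factors (and, perhaps, reflections of
factors) that does not match the boundary circles of the two base surfaces. -/
def IsOrthogonal : Prop :=
  ∃ τ : ∀ v, M.BlockTrivialization v, ∀ w : M.W,
    ∃ (σ : Equiv.Perm (Fin 3)) (ε : Fin 3 → ℤˣ), σ 0 ≠ 0 ∧
      ((torusTrivialization w (τ (M.orig w))).comp (M.glue w : C(Torus 3, Torus 3))).Homotopic
        ((signedPerm σ ε).comp (torusTrivialization (M.rev w) (τ (M.orig (M.rev w)))))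

/-! ### Invariants of the graph-manifold -/

/-- The gluing matrix `g_w`, `(z_{-w}, f_{-w}) = (z_w, f_w) · g_w`. -/
noncomputable def g (w : M.W) : Matrix (Fin 3) (Fin 3) ℤ :=
  h1Matrix (M.glue w : C(Torus 3, Torus 3))

/-- The intersection lattice `F_w ∩ F_{-w}` of the edge `w`, as a subgroup of the fiber group
`F_v = ℤ²` of the initial vertex `v` of `w`. -/
noncomputable def P (w : M.W) : Submodule ℤ (Fin 2 → ℤ) :=
  (fiberLattice ⊓ fiberLattice.map (M.g w).mulVecLin).comap (fiberIncl ℤ)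

/-- The type of a vertex: the maximal number of pairwise non-parallel edges that start there. -/
noncomputable def type (v : M.V) : ℕ :=
  sSup {k | ∃ S : Finset M.W, S.card = k ∧ (∀ w ∈ S, M.orig w = v) ∧
    (S : Set M.W).Pairwise fun w w' => M.P w ≠ M.P w'}

/-- The intersection number of an edge: the greatest common divisor of the entries of the row `b_w`
of the gluing matrix. -/
noncomputable def intersectionNumber (w : M.W) : ℕ := Int.gcd (M.g w 0 1) (M.g w 0 2)

/-- The group of fiber intersections of a vertex (of type 2), generated by its intersection
lattices. -/
noncomputable def fiberIntersections (v : M.V) : Submodule ℤ (Fin 2 → ℤ) :=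
  ⨆ (w : M.W) (_ : M.orig w = v), M.P w

/-- The secondary intersection number of a vertex (of type 2). -/
noncomputable def secondaryIntersectionNumber (v : M.V) : ℕ :=
  (M.fiberIntersections v).toAddSubgroup.index

/-- The wedge product of two vectors of a fiber space, in terms of `f¹ ∧ f²`. -/
def wedge (p q : Fin 2 → ℝ) : ℝ := p 0 * q 1 - p 1 * q 0

/-- The real vector with the given integer coordinates. -/
def toReal (p : Fin 2 → ℤ) : Fin 2 → ℝ := fun i => (p i : ℝ)

/-- The gluing isomorphism with real coefficients. -/
noncomputable def gReal (w : M.W) : Matrix (Fin 3) (Fin 3) ℝ := (M.g w).map (Int.cast : ℤ → ℝ)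

/-- `u`, an element of `F_{-w}`, is the generator of the intersection lattice of the edge `w` that
is positive for the intersection orientation of the oriented planes `F_w` and `F_{-w}` in the
oriented space `L_w`: if `a ∧ u = u_w` in `F_w` and `b ∧ u = u_{-w}` in `F_{-w}`, then the basis
`(a, b, u)` of `L_w` is positive. (`u'` is `u` viewed in `F_w`.) -/
def IsIntersectionOrientation (w : M.W) (u : Fin 2 → ℤ) : Prop :=
  M.P (M.rev w) = Submodule.span ℤ {u} ∧
    ∃ u' a b : Fin 2 → ℝ,
      (M.gReal w).mulVec (fiberIncl ℝ (toReal u)) = fiberIncl ℝ u' ∧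
      wedge a u' = 1 ∧ wedge b (toReal u) = 1 ∧
      0 < Matrix.det
        (Matrix.of ![fiberIncl ℝ a, (M.gReal w).mulVec (fiberIncl ℝ b), fiberIncl ℝ u'])

/-- The intersection orientation `u_{w ∩ -w}`, as an element of `F_{-w}`. -/
noncomputable def interOrientation (w : M.W) : Fin 2 → ℤ :=
  Classical.epsilon (M.IsIntersectionOrientation w)

/-- The directed edges that start at `v`. -/
abbrev Star (v : M.V) : Type := {w : M.W // M.orig w = v}

/-- The subspace `Q_v` of the direct sum of the spaces `F_{-w}`, `w ∈ ∂v`: for some `α`,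
`q_{-w} ∧ u_{w ∩ -w} = α u_{-w}` for all `w`. -/
noncomputable def Q (v : M.V) : Submodule ℝ (M.Star v → Fin 2 → ℝ) where
  carrier := {q | ∃ α : ℝ, ∀ w : M.Star v, wedge (q w) (toReal (M.interOrientation w)) = α}
  zero_mem' := ⟨0, fun w => by simp [wedge]⟩
  add_mem' := by
    rintro p q ⟨α, hα⟩ ⟨β, hβ⟩
    refine ⟨α + β, fun w => ?_⟩
    rw [← hα w, ← hβ w]
    simp only [wedge, Pi.add_apply]
    ring
  smul_mem' := by
    rintro c q ⟨α, hα⟩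
    refine ⟨c * α, fun w => ?_⟩
    rw [← hα w]
    simp only [wedge, Pi.smul_apply, smul_eq_mul]
    ring

/-- The map `D_w : F_{-w} → F_w`, given by the block `d_w` of the gluing matrix. -/
noncomputable def D (w : M.W) : (Fin 2 → ℝ) →ₗ[ℝ] (Fin 2 → ℝ) :=
  ((M.gReal w).submatrix Fin.succ Fin.succ).mulVecLin

open Classical in
/-- The charge map `K_v : Q_v → F_v`. -/
noncomputable def K (v : M.V) : M.Q v →ₗ[ℝ] (Fin 2 → ℝ) :=
  (∑ w : M.Star v, (1 / (M.intersectionNumber w : ℝ)) • (M.D w ∘ₗ LinearMap.proj w)).domRestrict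
    (M.Q v)

/-- The intersection lattice of the terminal vertex of `w` (of type 2) that is not the intersection
lattice of the edge `w`. -/
noncomputable def otherLattice (w : M.W) : Submodule ℤ (Fin 2 → ℤ) :=
  ⨆ (w' : M.W) (_ : M.orig w' = M.orig (M.rev w)) (_ : M.P w' ≠ M.P (M.rev w)), M.P w'

/-- The line `J_{-w}` in `F_{-w}` spanned by `otherLattice w`. -/
noncomputable def J (w : M.W) : Submodule ℝ (Fin 2 → ℝ) :=
  Submodule.span ℝ (toReal '' (M.otherLattice w : Set (Fin 2 → ℤ)))

/-- The subspace `B_v` of intersection vectors, the intersection of `Q_v` with the direct sum of the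
lines `J_{-w}`. -/
noncomputable def B (v : M.V) : Submodule ℝ (M.Q v) :=
  (Submodule.pi Set.univ fun w : M.Star v => M.J w).comap (M.Q v).subtype

end GraphManifold

/-! ### Lifts to the universal cover of the circle -/

/-! Maps of tori are classified up to homotopy by their matrices on `H₁`, so orthogonality is a
question about integer matrices. A change of trivialization over `v` acts on `H₁(T_w)` by `frame x_w
A = (1, 0; x_w, A)`. The matrix `A` is the same for all `w ∈ ∂v`, because `Φ_v` is connected. The
`x_w` are the degrees of a map `Φ_v → T²` on the boundary circles, and the families that occur are
exactly those with sum zero (`IsBaseSurface.sum_degree_eq_zero`, `IsBaseSurface.exists_degree_eq`).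
Hence `isOrthogonal_iff`: one looks for bases `E v` of the fiber groups and shifts `y w`, with sum
zero at each vertex, such that every `g_w` is a signed permutation in the bases `(z_w + y_w, E v)`.

A signed permutation with `σ 0 ≠ 0` sends one basis vector of `F_{-w}` to `±(z_w + y_w)` and the
other one into `F_w`. The latter therefore generates the intersection lattice, and `b_w` is `±1` on
the former. Bases of this kind are called adapted (`IsAdapted`). Conditions (1) and (2) hold as soon
as an adapted basis exists, and conversely they produce one from generators of the two intersection
lattices at each vertex (`exists_isAdapted`).

In an adapted basis the shifts are forced: `y_w` is `edgeShift`, up to sign the image under `d_w` of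
the vector complementary to the intersection. The space `B_v` is the line spanned by the family of
these complementary vectors with their signs, and `K_v` maps that family to the sum of the shifts.
So (3) says precisely that the forced shifts have sum zero (`IsAdapted.B_le_ker_K_iff`). -/

theorem exists_real_lift {A : Type*} [TopologicalSpace A] [SimplyConnectedSpace A]
    [LocallyPathConnectedSpace A] (f : C(A, UnitAddCircle)) :
    ∃ F : C(A, ℝ), ∀ a, ((F a : ℝ) : UnitAddCircle) = f a := by
  have cov : IsCoveringMap ((↑) : ℝ → UnitAddCircle) := AddCircle.isCoveringMap_coe 1
  let a₀ : A := Classical.arbitrary A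
  obtain ⟨e, he⟩ := QuotientAddGroup.mk_surjective (f a₀)
  obtain ⟨F, ⟨-, hF⟩, -⟩ := cov.existsUnique_continuousMap_lifts f a₀ e he
  exact ⟨F, fun x => congrFun hF x⟩

theorem coe_intCast_unitAddCircle (n : ℤ) : ((n : ℝ) : UnitAddCircle) = 0 :=
  (AddCircle.coe_eq_zero_iff 1).2 ⟨n, by simp⟩

theorem exists_int_eq_sub_of_coe_eq {x y : ℝ} (h : (x : UnitAddCircle) = (y : UnitAddCircle)) :
    ∃ n : ℤ, x - y = n := by
  obtain ⟨n, hn⟩ := (AddCircle.coe_eq_zero_iff 1).1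
    (show ((x - y : ℝ) : UnitAddCircle) = 0 by rw [AddCircle.coe_sub, h, sub_self])
  exact ⟨n, by simpa using hn.symm⟩

theorem eq_of_continuous_of_forall_exists_int {X : Type*} [TopologicalSpace X]
    [PreconnectedSpace X] {f : X → ℝ} (hf : Continuous f) (h : ∀ x, ∃ n : ℤ, f x = n) (x y : X) :
    f x = f y := by
  choose n hn using h
  have hc : Continuous n := by
    -- The integer-valued function is continuous because `ℤ` is embedded in `ℝ`.
    rw [Int.isClosedEmbedding_coe_real.isInducing.continuous_iff]
    convert hf using 1
    exact funext fun x => (hn x).symm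
  rw [hn, hn, PreconnectedSpace.constant ‹_› hc]

theorem hasDegree_degree (c : C(UnitAddCircle, UnitAddCircle)) : HasDegree c (degree c) :=
  (existsUnique_hasDegree c).choose_spec.1

theorem HasDegree.degree_eq {c : C(UnitAddCircle, UnitAddCircle)} {n : ℤ} (h : HasDegree c n) :
    degree c = n :=
  (existsUnique_hasDegree c).unique (hasDegree_degree c) h

/-- In a lift of the homotopy, the increment over one period is an integer depending continuously on
time, hence constant. -/
theorem degree_eq_of_homotopic {c c' : C(UnitAddCircle, UnitAddCircle)} (h : c.Homotopic c') :
    degree c = degree c' := by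
  obtain ⟨H⟩ := h
  -- Time is extended constantly beyond `[0, 1]`, so that the lift is taken over the plane.
  let f : C(ℝ × ℝ, UnitAddCircle) :=
    ⟨fun p => H (Set.projIcc (0 : ℝ) 1 zero_le_one p.1, (p.2 : UnitAddCircle)), by
      refine H.continuous.comp ((continuous_projIcc.comp continuous_fst).prodMk ?_)
      exact (AddCircle.continuous_mk' 1).comp continuous_snd⟩
  obtain ⟨K, hK⟩ := exists_real_lift f
  have h01 : ((1 : ℝ) : UnitAddCircle) = ((0 : ℝ) : UnitAddCircle) := by
    simp [AddCircle.coe_period]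
  have hdiff : ∀ t : ℝ, ∃ n : ℤ, K (t, 1) - K (t, 0) = n := fun t => by
    apply exists_int_eq_sub_of_coe_eq
    rw [hK, hK]
    simp [f, h01]
  have hconst := eq_of_continuous_of_forall_exists_int
    (f := fun t => K (t, 1) - K (t, 0)) (by fun_prop) hdiff 0 1
  obtain ⟨n, hn⟩ := hdiff 0
  have h0 : HasDegree c n := by
    refine ⟨⟨fun x => K (0, x), by fun_prop⟩, fun x => ?_, hn⟩
    change ((K (0, x) : ℝ) : UnitAddCircle) = _
    rw [hK]
    simp [f]
  have h1 : HasDegree c' n := by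
    refine ⟨⟨fun x => K (1, x), by fun_prop⟩, fun x => ?_, hconst.symm.trans hn⟩
    change ((K (1, x) : ℝ) : UnitAddCircle) = _
    rw [hK]
    simp [f]
  rw [h0.degree_eq, h1.degree_eq]

/-! ### Maps of tori -/

/-- The universal covering of a torus. -/
def torusProj (n : ℕ) : C(Fin n → ℝ, Torus n) :=
  ⟨fun x i => (x i : UnitAddCircle), continuous_pi fun i =>
    (AddCircle.continuous_mk' 1).comp (continuous_apply i)⟩

theorem isOpenQuotientMap_torusProj (n : ℕ) : IsOpenQuotientMap (torusProj n) :=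
  IsOpenQuotientMap.piMap fun _ => QuotientAddGroup.isOpenQuotientMap_mk

/-- The integral vector `k` as a real vector. -/
def intVec {n : ℕ} (k : Fin n → ℤ) : Fin n → ℝ := fun i => (k i : ℝ)

theorem torusProj_add_intVec {n : ℕ} (x : Fin n → ℝ) (k : Fin n → ℤ) :
    torusProj n (x + intVec k) = torusProj n x := by
  ext i
  simp [torusProj, intVec]

theorem exists_intVec_of_torusProj_eq {n : ℕ} {x y : Fin n → ℝ}
    (h : torusProj n x = torusProj n y) : ∃ k : Fin n → ℤ, x = y + intVec k := by
  choose k hk using fun i => exists_int_eq_sub_of_coe_eq (congrFun h i)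
  refine ⟨k, funext fun i => ?_⟩
  simp [intVec, ← hk i]

theorem intVec_mulVec {m n : ℕ} (A : Matrix (Fin n) (Fin m) ℤ) (k : Fin m → ℤ) :
    intVec (A.mulVec k) = (A.map (Int.cast : ℤ → ℝ)).mulVec (intVec k) := by
  ext i
  simp [intVec, Matrix.mulVec, dotProduct]

/-- The map of tori `f` has a lift to the universal covers on which the deck transformations act
through `A`. -/
def HasLift {m n : ℕ} (f : C(Torus m, Torus n)) (A : Matrix (Fin n) (Fin m) ℤ) : Prop :=
  ∃ F : C(Fin m → ℝ, Fin n → ℝ), (∀ x, torusProj n (F x) = f (torusProj m x)) ∧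
    ∀ x k, F (x + intVec k) = F x + intVec (A.mulVec k)

/-- The increment of a lift under a deck translation is integral, so by continuity it does not
depend on the point. It is therefore additive in the translation, and its values on the standard
basis are the columns of the matrix. -/
theorem exists_hasLift {m n : ℕ} (f : C(Torus m, Torus n)) : ∃ A, HasLift f A := by
  choose F hF using fun i => exists_real_lift ((coord i).comp (f.comp (torusProj m)))
  let G : C(Fin m → ℝ, Fin n → ℝ) := ⟨fun x i => F i x, by fun_prop⟩
  have hG : ∀ x, torusProj n (G x) = f (torusProj m x) := fun x => funext fun i => hF i x
  have hdiff : ∀ (k : Fin m → ℤ) (i : Fin n) (x : Fin m → ℝ),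
      ∃ a : ℤ, F i (x + intVec k) - F i x = a := fun k i x => by
    apply exists_int_eq_sub_of_coe_eq
    rw [hF, hF]
    simp [torusProj_add_intVec]
  have hconst : ∀ (k : Fin m → ℤ) (i : Fin n) (x : Fin m → ℝ),
      F i (x + intVec k) - F i x = F i (0 + intVec k) - F i 0 := fun k i x =>
    eq_of_continuous_of_forall_exists_int (f := fun x => F i (x + intVec k) - F i x)
      (by fun_prop) (hdiff k i) x 0
  choose a ha using fun k i => hdiff k i 0
  have hadd : ∀ i k l, a (k + l) i = a k i + a l i := fun i k l => by
    have h1 := hconst l i (0 + intVec k)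
    have h2 : (0 : Fin m → ℝ) + intVec k + intVec l = 0 + intVec (k + l) := by
      ext j
      simp [intVec]
    rw [h2, ha l i] at h1
    have h3 := ha k i
    have h4 := ha (k + l) i
    have : (a (k + l) i : ℝ) = a k i + a l i := by linarith
    exact_mod_cast this
  let φ : Fin n → ((Fin m → ℤ) →+ ℤ) := fun i => AddMonoidHom.mk' (fun k => a k i) (hadd i)
  refine ⟨Matrix.of fun i j => a (Pi.single j 1) i, G, hG, fun x k => funext fun i => ?_⟩
  have h1 : a k i = ∑ j, a (Pi.single j 1) i * k j := by
    have := (φ i).toIntLinearMap.pi_apply_eq_sum_univ k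
    simp only [AddMonoidHom.coe_toIntLinearMap, smul_eq_mul] at this
    change a k i = _ at this
    rw [this]
    refine Finset.sum_congr rfl fun j _ => ?_
    rw [mul_comm]
    congr 1
    change a _ i = _
    congr 1
    ext l
    simp [Pi.single_apply, eq_comm]
  have h2 := hconst k i x
  rw [ha, h1] at h2
  simp only [G, ContinuousMap.coe_mk, Pi.add_apply, intVec, Matrix.mulVec, dotProduct,
    Matrix.of_apply]
  linarith

/-- Restricting the lift to a coordinate axis gives lifts that compute the degrees. Any lift thus
determines `h1Matrix`, and functoriality reduces to composing lifts. -/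
theorem HasLift.h1Matrix_eq {m n : ℕ} {f : C(Torus m, Torus n)} {A : Matrix (Fin n) (Fin m) ℤ}
    (h : HasLift f A) : h1Matrix f = A := by
  obtain ⟨F, hF, hA⟩ := h
  ext i j
  refine HasDegree.degree_eq ⟨⟨fun x => F (Function.update 0 j x) i, by fun_prop⟩, fun x => ?_, ?_⟩
  · have h1 := congrFun (hF (Function.update 0 j x)) i
    have h2 : torusProj m (Function.update 0 j x) = coordCircle j (x : UnitAddCircle) := by
      ext l
      by_cases hl : l = j
      · subst hl; simp [torusProj, coordCircle]
      · simp [torusProj, coordCircle, hl]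
    rw [h2] at h1
    exact h1
  · have h1 := congrFun (hA 0 (Pi.single j 1)) i
    have h2 : (0 : Fin m → ℝ) + intVec (Pi.single j 1) = Function.update (0 : Fin m → ℝ) j 1 := by
      ext l
      by_cases hl : l = j
      · subst hl; simp [intVec]
      · simp [intVec, hl]
    rw [h2] at h1
    have h3 : Function.update (0 : Fin m → ℝ) j 0 = 0 := by simp
    simp only [ContinuousMap.coe_mk, h1, h3, Pi.add_apply]
    simp [intVec]

theorem hasLift_h1Matrix {m n : ℕ} (f : C(Torus m, Torus n)) : HasLift f (h1Matrix f) := by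
  obtain ⟨A, hA⟩ := exists_hasLift f
  rwa [hA.h1Matrix_eq]

theorem h1Matrix_comp {l m n : ℕ} (f : C(Torus m, Torus n)) (f' : C(Torus l, Torus m)) :
    h1Matrix (f.comp f') = h1Matrix f * h1Matrix f' := by
  obtain ⟨F, hF, hA⟩ := hasLift_h1Matrix f
  obtain ⟨F', hF', hA'⟩ := hasLift_h1Matrix f'
  refine HasLift.h1Matrix_eq ⟨F.comp F', fun x => ?_, fun x k => ?_⟩
  · simp [hF, hF']
  · simp [hA, hA']

theorem h1Matrix_id (n : ℕ) : h1Matrix (ContinuousMap.id (Torus n)) = 1 :=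
  HasLift.h1Matrix_eq ⟨ContinuousMap.id _, fun _ => rfl, fun x k => by simp⟩

theorem h1Matrix_eq_of_homotopic {m n : ℕ} {f f' : C(Torus m, Torus n)} (h : f.Homotopic f') :
    h1Matrix f = h1Matrix f' := by
  ext i j
  exact degree_eq_of_homotopic
    (.comp (.refl (coord i)) (.comp h (.refl (coordCircle j))))

/-- Equal matrices make the difference of the lifts periodic, so it descends to a map `D` from the
torus to `ℝⁿ`. Shrinking `D` linearly to zero is the homotopy. -/
theorem homotopic_of_h1Matrix_eq {m n : ℕ} {f f' : C(Torus m, Torus n)}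
    (h : h1Matrix f = h1Matrix f') : f.Homotopic f' := by
  obtain ⟨F, hF, hA⟩ := hasLift_h1Matrix f
  obtain ⟨F', hF', hA'⟩ := hasLift_h1Matrix f'
  let G : C(Fin m → ℝ, Fin n → ℝ) := F' - F
  have hG : ∀ x y, torusProj m x = torusProj m y → G x = G y := fun x y hxy => by
    obtain ⟨k, rfl⟩ := exists_intVec_of_torusProj_eq hxy
    simp [G, hA, hA', h]
  have hq := (isOpenQuotientMap_torusProj m).isQuotientMap
  let D : C(Torus m, Fin n → ℝ) := hq.lift G hG
  have hD : ∀ x, D (torusProj m x) = F' x - F x := fun x =>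
    DFunLike.congr_fun (hq.lift_comp G hG) x
  have hfin : ∀ y, f' y = f y + torusProj n (D y) := fun y => by
    obtain ⟨x, rfl⟩ := hq.surjective y
    rw [hD, ← hF, ← hF']
    ext i
    simp [torusProj]
  refine ⟨⟨⟨fun p => f p.2 + torusProj n ((p.1 : ℝ) • D p.2), by fun_prop⟩, fun y => ?_, fun y => ?_⟩⟩
  · have : torusProj n 0 = 0 := by ext i; simp [torusProj]
    simp [this]
  · simp [hfin]

theorem h1Matrix_signedPerm (σ : Equiv.Perm (Fin 3)) (ε : Fin 3 → ℤˣ) :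
    h1Matrix (signedPerm σ ε) = Matrix.of fun i j => if σ i = j then (ε i : ℤ) else 0 := by
  refine HasLift.h1Matrix_eq ⟨⟨fun x i => ((ε i : ℤ) : ℝ) * x (σ i), by fun_prop⟩,
    fun x => ?_, fun x k => ?_⟩
  · ext i
    simp only [torusProj, signedPerm, ContinuousMap.coe_mk]
    rw [← zsmul_eq_mul, AddCircle.coe_zsmul]
  · ext i
    simp [intVec, Matrix.mulVec, dotProduct, mul_add]

/-! ### Degrees on the boundary circles of a surface -/

theorem continuous_sidePoint (N : ℕ) : Continuous (sidePoint N) := by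
  unfold sidePoint
  fun_prop

theorem sidePoint_self {N : ℕ} (hN : N ≠ 0) : sidePoint N N = sidePoint N 0 := by
  have : (N : ℝ) ≠ 0 := by exact_mod_cast hN
  refine Subtype.ext ?_
  simp only [sidePoint]
  rw [mul_div_assoc, div_self this]
  simp [Complex.exp_two_pi_mul_I]

/-- The radial retraction of the plane onto the disc. -/
noncomputable def discRetraction : C(ℂ, Disc) :=
  ⟨fun z => ⟨((max 1 ‖z‖)⁻¹ : ℝ) • z, by
    have h : 0 < max 1 ‖z‖ := lt_max_of_lt_left one_pos
    rw [mem_closedBall_zero_iff, norm_smul, Real.norm_of_nonneg (by positivity),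
      inv_mul_le_iff₀ h, mul_one]
    exact le_max_right _ _⟩, by
    refine Continuous.subtype_mk
      (((continuous_const.max continuous_norm).inv₀ fun z => ?_).smul continuous_id) _
    exact (lt_max_of_lt_left one_pos).ne'⟩

theorem discRetraction_coe (z : Disc) : discRetraction z = z := by
  have : ‖(z : ℂ)‖ ≤ 1 := mem_closedBall_zero_iff.1 z.2
  refine Subtype.ext ?_
  simp [discRetraction, max_eq_left this]

/-- The disc is a retract of `ℂ`: lift over the plane and restrict. -/
theorem exists_real_lift_disc (f : C(Disc, UnitAddCircle)) :
    ∃ F : C(Disc, ℝ), ∀ z, ((F z : ℝ) : UnitAddCircle) = f z := by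
  obtain ⟨F, hF⟩ := exists_real_lift (f.comp discRetraction)
  refine ⟨F.comp ⟨Subtype.val, continuous_subtype_val⟩, fun z => ?_⟩
  simp [hF, discRetraction_coe]

theorem sum_range_polygon {R : Type*} [AddCommMonoid R] (d : ℕ → R) (g k : ℕ) :
    ∑ j ∈ Finset.range (4 * g + 3 * k), d j =
      ∑ i ∈ Finset.range g, (d (4 * i) + d (4 * i + 1) + d (4 * i + 2) + d (4 * i + 3)) +
      ∑ i ∈ Finset.range k,
        (d (4 * g + 3 * i) + d (4 * g + 3 * i + 1) + d (4 * g + 3 * i + 2)) := by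
  have h1 : ∀ g, ∑ j ∈ Finset.range (4 * g), d j =
      ∑ i ∈ Finset.range g, (d (4 * i) + d (4 * i + 1) + d (4 * i + 2) + d (4 * i + 3)) := by
    intro g
    induction g with
    | zero => simp
    | succ g ih =>
      rw [Finset.sum_range_succ, ← ih, show 4 * (g + 1) = 4 * g + 3 + 1 by ring,
        Finset.sum_range_succ, Finset.sum_range_succ _ (4 * g + 2),
        Finset.sum_range_succ _ (4 * g + 1), Finset.sum_range_succ]
      simp only [add_assoc]
  induction k with
  | zero => simp [h1]
  | succ k ih =>
    rw [Finset.sum_range_succ, ← add_assoc, ← ih,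
      show 4 * g + 3 * (k + 1) = 4 * g + 3 * k + 2 + 1 by ring,
      Finset.sum_range_succ, Finset.sum_range_succ _ (4 * g + 3 * k + 1), Finset.sum_range_succ]
    simp only [add_assoc]

theorem StdSurface.boundary_coe (g k : ℕ) (i : Fin k) {s : ℝ} (hs : s ∈ Set.Icc (0 : ℝ) 1) :
    StdSurface.boundary g k i (s : UnitAddCircle) =
      Quot.mk _ (sidePoint (4 * g + 3 * k) ((4 * g + 3 * i + 1 : ℕ) + s)) := by
  unfold StdSurface.boundary
  rcases hs.2.eq_or_lt with rfl | h1
  · have h0 : ((1 : ℝ) : UnitAddCircle) = ((0 : ℝ) : UnitAddCircle) := by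
      simp [AddCircle.coe_period]
    rw [h0, AddCircle.equivIco_coe_of_mem (p := (1 : ℝ)) (a := 0) (y := 0) (by simp)]
    -- The end points of the side `cᵢ` are identified by the gluing of the sides `dᵢ` adjacent to
    -- it.
    have := Quot.sound (SideRel.glue (g := g) (k := k) _ _ (SidesPaired.d i) 1 (by simp))
    convert this using 3 <;> push_cast <;> ring
  · rw [AddCircle.equivIco_coe_of_mem (p := (1 : ℝ)) (a := 0) (by simpa using ⟨hs.1, h1⟩)]

/-- Lift the pullback of `c` to the polygon. The total increment around its boundary is zero, paired
sides cancel, and the free side of each boundary circle contributes its degree. -/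
theorem IsBaseSurface.sum_degree_eq_zero {Φ ι : Type} [TopologicalSpace Φ] [Fintype ι]
    {γ : ι → C(UnitAddCircle, Φ)} (hγ : IsBaseSurface γ) (c : C(Φ, UnitAddCircle)) :
    ∑ w, degree (c.comp (γ w)) = 0 := by
  obtain ⟨g, k, e, h, hk, -, -, hb⟩ := hγ
  set N := 4 * g + 3 * k with hN
  let p : C(Disc, UnitAddCircle) :=
    ⟨fun z => c (h (Quot.mk _ z)), by
      exact c.continuous.comp (h.continuous.comp continuous_quot_mk)⟩
  obtain ⟨F, hF⟩ := exists_real_lift_disc p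
  let G : ℝ → ℝ := fun t => F (sidePoint N t)
  have hGc : Continuous G := F.continuous.comp (continuous_sidePoint N)
  have hG : ∀ t, ((G t : ℝ) : UnitAddCircle) = c (h (Quot.mk _ (sidePoint N t))) := fun t => hF _
  have hpair : ∀ i j, SidesPaired g k i j →
      (G ((i + 1 : ℕ)) - G i) + (G ((j + 1 : ℕ)) - G j) = 0 := fun i j hij => by
    have := eq_of_continuous_of_forall_exists_int (X := Set.Icc (0 : ℝ) 1)
      (f := fun s => G (i + s) - G (j + (1 - s))) (by fun_prop) (fun s => by
        apply exists_int_eq_sub_of_coe_eq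
        rw [hG, hG, Quot.sound (SideRel.glue i j hij s s.2)])
      ⟨0, by simp⟩ ⟨1, by simp⟩
    simp only [add_zero, sub_zero, sub_self] at this
    push_cast
    linarith
  have hfree : ∀ i : Fin k, G ((4 * g + 3 * i + 1 + 1 : ℕ)) - G ((4 * g + 3 * i + 1 : ℕ)) =
      degree (c.comp (γ (e i))) := fun i => by
    obtain ⟨L, hL, hL1⟩ := hasDegree_degree (c.comp (γ (e i)))
    have := eq_of_continuous_of_forall_exists_int (X := Set.Icc (0 : ℝ) 1)
      (f := fun s => G ((4 * g + 3 * i + 1 : ℕ) + s) - L s) (by fun_prop) (fun s => by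
        apply exists_int_eq_sub_of_coe_eq
        rw [hG, hL, ContinuousMap.comp_apply, ← hb, StdSurface.boundary_coe g k i s.2])
      ⟨0, by simp⟩ ⟨1, by simp⟩
    simp only [add_zero] at this
    rw [← hL1]
    push_cast at this ⊢
    linarith
  have htotal : ∑ j ∈ Finset.range N, (G ((j + 1 : ℕ)) - G j) = 0 := by
    rw [Finset.sum_range_sub (fun j : ℕ => G j)]
    simp only [G, sidePoint_self (show N ≠ 0 by omega), Nat.cast_zero, sub_self]
  rw [hN, sum_range_polygon, Finset.sum_eq_zero, zero_add, Finset.sum_range] at htotal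
  · have h1 : ∑ i : Fin k, (degree (c.comp (γ (e i))) : ℝ) = 0 := by
      rw [← htotal]
      refine Finset.sum_congr rfl fun i _ => ?_
      have h2 := hpair _ _ (SidesPaired.d i)
      have h3 := hfree i
      push_cast at h2 h3 ⊢
      linarith
    rw [← e.sum_comp]
    exact_mod_cast h1
  · intro i hi
    have ha := hpair _ _ (SidesPaired.a (k := k) ⟨i, Finset.mem_range.1 hi⟩)
    have hb := hpair _ _ (SidesPaired.b (k := k) ⟨i, Finset.mem_range.1 hi⟩)
    push_cast at ha hb ⊢
    linarith

/-- `G` descends to a function on the boundary circle, a closed subset of the disc, and Tietze's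
theorem extends it. -/
theorem exists_disc_extension {N : ℕ} (hN : N ≠ 0) {G : ℝ → ℝ} (hG : Continuous G)
    (h0 : G 0 = G N) :
    ∃ F : C(Disc, ℝ), ∀ t ∈ Set.Icc (0 : ℝ) N, F (sidePoint N t) = G t := by
  have hN' : 0 < (N : ℝ) := by exact_mod_cast Nat.pos_of_ne_zero hN
  have : Fact (0 < (N : ℝ)) := ⟨hN'⟩
  let e : AddCircle (N : ℝ) → Disc := fun x => ⟨(AddCircle.toCircle x : ℂ), by
    rw [mem_closedBall_zero_iff, Circle.norm_coe]⟩
  have hec : Continuous e :=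
    (continuous_subtype_val.comp AddCircle.continuous_toCircle).subtype_mk _
  have hei : Function.Injective e := fun x y hxy =>
    AddCircle.injective_toCircle hN'.ne' (Circle.ext (congrArg (fun z : Disc => (z : ℂ)) hxy))
  have he : ∀ t : ℝ, e (t : AddCircle (N : ℝ)) = sidePoint N t := fun t => Subtype.ext <| by
    simp only [e, AddCircle.toCircle_apply_mk, Circle.coe_exp, sidePoint]
    congr 3
    ring
  let f : C(AddCircle (N : ℝ), ℝ) :=
    ⟨AddCircle.liftIco (N : ℝ) 0 G,
      AddCircle.liftIco_continuous (by simpa using h0) hG.continuousOn⟩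
  obtain ⟨F, hF⟩ := f.exists_extension (hec.isClosedEmbedding hei)
  refine ⟨F, fun t ht => ?_⟩
  have h1 : ∀ t ∈ Set.Ico (0 : ℝ) N, F (sidePoint N t) = G t := fun t ht => by
    rw [← he]
    refine (DFunLike.congr_fun hF (t : AddCircle (N : ℝ))).trans ?_
    exact AddCircle.liftIco_coe_apply (by simpa using ht)
  rcases ht.2.eq_or_lt with rfl | h
  · rw [sidePoint_self hN, h1 0 (by simpa using hN'), h0]
  · exact h1 t ⟨ht.1, h⟩

/-- Converse of the vanishing of the sum. On the boundary of the polygon take the function that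
climbs by the prescribed degree along each free side and is a constant integer on every paired side.
It closes up because the degrees have sum zero, and it extends to the disc. Modulo `1` it vanishes
on the paired sides, so it respects the gluing. -/
theorem IsBaseSurface.exists_degree_eq {Φ ι : Type} [TopologicalSpace Φ] [Fintype ι]
    {γ : ι → C(UnitAddCircle, Φ)} (hγ : IsBaseSurface γ) (n : ι → ℤ) (hn : ∑ w, n w = 0) :
    ∃ c : C(Φ, UnitAddCircle), ∀ w, degree (c.comp (γ w)) = n w := by
  obtain ⟨g, k, e, h, hk, -, -, hb⟩ := hγ
  set N := 4 * g + 3 * k with hN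
  let clamp : ℝ → ℝ := fun x => max 0 (min 1 x)
  have clamp_le : ∀ x ≤ 0, clamp x = 0 := fun x hx => by
    simp [clamp, hx]
  have clamp_ge : ∀ x, 1 ≤ x → clamp x = 1 := fun x hx => by
    simp [clamp, hx]
  have clamp_self : ∀ x ∈ Set.Icc (0 : ℝ) 1, clamp x = x := fun x hx => by
    simp [clamp, hx.1, hx.2]
  -- The ramp of the `l`-th boundary circle: constant outside its free side, which begins at the
  -- parameter `4g + 3l + 1`.
  let term : Fin k → ℝ → ℝ := fun l t => n (e l) * clamp (t - (4 * g + 3 * l + 1 : ℕ))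
  have hterm : ∀ (l : Fin k) (i : ℕ), i ≠ 4 * g + 3 * l + 1 → ∀ s ∈ Set.Icc (0 : ℝ) 1,
      ((term l (i + s) : ℝ) : UnitAddCircle) = 0 := fun l i hi s hs => by
    rcases Nat.lt_or_gt_of_ne hi with hlt | hgt
    · have : (i : ℝ) + 1 ≤ (4 * g + 3 * l + 1 : ℕ) := by exact_mod_cast hlt
      simp only [term]
      rw [clamp_le _ (by linarith [hs.2])]
      simp
    · have : ((4 * g + 3 * l + 1 : ℕ) : ℝ) + 1 ≤ i := by exact_mod_cast hgt
      simp only [term]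
      rw [clamp_ge _ (by linarith [hs.1]), mul_one]
      exact coe_intCast_unitAddCircle _
  let G : ℝ → ℝ := fun t => ∑ l, term l t
  have hGcoe : ∀ t, ((G t : ℝ) : UnitAddCircle) = ∑ l, ((term l t : ℝ) : UnitAddCircle) :=
    fun t => map_sum (QuotientAddGroup.mk' (AddSubgroup.zmultiples (1 : ℝ))) _ _
  have hGc : Continuous G := by
    simp only [G, term, clamp]
    fun_prop
  have hG0 : G 0 = G N := by
    have h1 : G 0 = 0 := Finset.sum_eq_zero fun l _ => by
      simp only [term]
      rw [clamp_le _ (by simp only [zero_sub, neg_nonpos]; positivity), mul_zero]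
    have h2 : G N = ∑ l, (n (e l) : ℝ) := Finset.sum_congr rfl fun l _ => by
      simp only [term]
      rw [clamp_ge, mul_one]
      have : 4 * g + 3 * (l : ℕ) + 1 + 1 ≤ N := by omega
      have : ((4 * g + 3 * (l : ℕ) + 1 : ℕ) : ℝ) + 1 ≤ N := by exact_mod_cast this
      linarith
    rw [h1, h2]
    have h3 := e.sum_comp n
    rw [hn] at h3
    exact_mod_cast h3.symm
  obtain ⟨F, hF⟩ := exists_disc_extension (show N ≠ 0 by omega) hGc hG0
  have hFG : ∀ i : ℕ, i < N → ∀ s ∈ Set.Icc (0 : ℝ) 1,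
      F (sidePoint N (i + s)) = G (i + s) := fun i hi s hs => by
    refine hF _ ⟨add_nonneg (Nat.cast_nonneg _) hs.1, ?_⟩
    have : (i : ℝ) + 1 ≤ N := by exact_mod_cast hi
    linarith [hs.2]
  have hzero : ∀ i : ℕ, i < N → (∀ l : Fin k, i ≠ 4 * g + 3 * l + 1) → ∀ s ∈ Set.Icc (0 : ℝ) 1,
      ((F (sidePoint N (i + s)) : ℝ) : UnitAddCircle) = 0 := fun i hi hl s hs => by
    rw [hFG i hi s hs, hGcoe]
    exact Finset.sum_eq_zero fun l _ => hterm l i (hl l) s hs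
  have hpair : ∀ i j, SidesPaired g k i j → (i < N ∧ ∀ l : Fin k, i ≠ 4 * g + 3 * l + 1) ∧
      (j < N ∧ ∀ l : Fin k, j ≠ 4 * g + 3 * l + 1) := fun i j hij => by
    cases hij with
    | a i => exact ⟨⟨by omega, fun l => by omega⟩, by omega, fun l => by omega⟩
    | b i => exact ⟨⟨by omega, fun l => by omega⟩, by omega, fun l => by omega⟩
    | d i => exact ⟨⟨by omega, fun l => by omega⟩, by omega, fun l => by omega⟩
  let c₀ : C(StdSurface g k, UnitAddCircle) :=
    ⟨Quot.lift (fun z => ((F z : ℝ) : UnitAddCircle)) (by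
      rintro _ _ ⟨i, j, hij, s, hs⟩
      obtain ⟨hi, hj⟩ := hpair i j hij
      rw [hzero i hi.1 hi.2 s hs,
        hzero j hj.1 hj.2 (1 - s) ⟨by linarith [hs.2], by linarith [hs.1]⟩]),
      continuous_quot_lift _ ((AddCircle.continuous_mk' 1).comp F.continuous)⟩
  refine ⟨c₀.comp ⟨h.symm, h.symm.continuous⟩, fun w => ?_⟩
  obtain ⟨i, rfl⟩ := e.surjective w
  refine HasDegree.degree_eq ⟨⟨fun x => n (e i) * x, by fun_prop⟩, fun x => ?_, by simp⟩
  obtain ⟨y, hy, hxy⟩ : ∃ y ∈ Set.Ico (0 : ℝ) 1, (y : UnitAddCircle) = (x : UnitAddCircle) :=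
    ⟨AddCircle.equivIco (1 : ℝ) 0 (x : UnitAddCircle),
      by simpa only [zero_add] using (AddCircle.equivIco (1 : ℝ) 0 (x : UnitAddCircle)).2,
      AddCircle.coe_equivIco⟩
  have hy' : y ∈ Set.Icc (0 : ℝ) 1 := ⟨hy.1, hy.2.le⟩
  have h1 : c₀ (h.symm (γ (e i) (x : UnitAddCircle))) = ((n (e i) * y : ℝ) : UnitAddCircle) := by
    rw [← hb, h.symm_apply_apply, ← hxy, StdSurface.boundary_coe g k i hy']
    change ((F (sidePoint N _) : ℝ) : UnitAddCircle) = _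
    rw [hFG _ (by omega) y hy', hGcoe, Finset.sum_eq_single i]
    · simp only [term, add_sub_cancel_left, clamp_self y hy']
    · intro l _ hl
      refine hterm l _ (fun h => hl (Fin.ext ?_)) y hy'
      omega
    · simp
  change ((n (e i) * x : ℝ) : UnitAddCircle) = c₀ (h.symm (γ (e i) (x : UnitAddCircle)))
  rw [h1, ← zsmul_eq_mul, ← zsmul_eq_mul, AddCircle.coe_zsmul, AddCircle.coe_zsmul, hxy]

theorem IsBaseSurface.pathConnectedSpace {Φ ι : Type} [TopologicalSpace Φ]
    {γ : ι → C(UnitAddCircle, Φ)} (hγ : IsBaseSurface γ) : PathConnectedSpace Φ := by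
  obtain ⟨g, k, e, h, -⟩ := hγ
  have : PathConnectedSpace Disc := isPathConnected_iff_pathConnectedSpace.1
    ((convex_closedBall (0 : ℂ) 1).isPathConnected ⟨0, by simp⟩)
  exact (h.surjective.comp Quot.mk_surjective).pathConnectedSpace
    (h.continuous.comp continuous_quot_mk)

/-! ### Trivializations of the blocks -/

/-- The matrix `(1, 0; y, E)` of a change of trivialization on the homology of a boundary torus. -/
def frame (y : Fin 2 → ℤ) (E : Matrix (Fin 2) (Fin 2) ℤ) : Matrix (Fin 3) (Fin 3) ℤ :=
  Matrix.of (Fin.cons (Fin.cons 1 0) fun i => Fin.cons (y i) (E i))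

@[simp]
theorem frame_zero_zero (y : Fin 2 → ℤ) (E : Matrix (Fin 2) (Fin 2) ℤ) : frame y E 0 0 = 1 := rfl

@[simp]
theorem frame_zero_succ (y : Fin 2 → ℤ) (E : Matrix (Fin 2) (Fin 2) ℤ) (j : Fin 2) :
    frame y E 0 j.succ = 0 := rfl

@[simp]
theorem frame_succ_zero (y : Fin 2 → ℤ) (E : Matrix (Fin 2) (Fin 2) ℤ) (i : Fin 2) :
    frame y E i.succ 0 = y i := rfl

@[simp]
theorem frame_succ_succ (y : Fin 2 → ℤ) (E : Matrix (Fin 2) (Fin 2) ℤ) (i j : Fin 2) :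
    frame y E i.succ j.succ = E i j := rfl

theorem frame_mul (x y : Fin 2 → ℤ) (A E : Matrix (Fin 2) (Fin 2) ℤ) :
    frame x A * frame y E = frame (x + A.mulVec y) (A * E) := by
  ext i j
  rw [Matrix.mul_apply, Fin.sum_univ_succ]
  refine Fin.cases ?_ (fun i => ?_) i <;> refine Fin.cases ?_ (fun j => ?_) j <;>
    simp only [frame_zero_zero, frame_zero_succ, frame_succ_zero, frame_succ_succ, Pi.add_apply,
      Matrix.mul_apply, Matrix.mulVec, dotProduct, mul_one, mul_zero, zero_mul, zero_add, add_zero,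
      Finset.sum_const_zero]

theorem frame_zero_one : frame 0 1 = 1 := by
  ext i j
  refine Fin.cases ?_ (fun i => ?_) i <;> refine Fin.cases ?_ (fun j => ?_) j <;>
    simp [Matrix.one_apply, Fin.succ_ne_zero, (Fin.succ_ne_zero _).symm]

theorem frame_mul_frame_neg {x : Fin 2 → ℤ} {A E : Matrix (Fin 2) (Fin 2) ℤ} (h : A * E = 1) :
    frame x A * frame (-E.mulVec x) E = 1 := by
  rw [frame_mul, Matrix.mulVec_neg, Matrix.mulVec_mulVec, h, Matrix.one_mulVec, add_neg_cancel,
    frame_zero_one]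

theorem frame_neg_mul_frame {x : Fin 2 → ℤ} {A E : Matrix (Fin 2) (Fin 2) ℤ} (h : E * A = 1) :
    frame (-E.mulVec x) E * frame x A = 1 := by
  rw [frame_mul, h, neg_add_cancel, frame_zero_one]

/-- The matrix of a signed permutation of the circle factors. -/
def signedPermMatrix (σ : Equiv.Perm (Fin 3)) (ε : Fin 3 → ℤˣ) : Matrix (Fin 3) (Fin 3) ℤ :=
  Matrix.of fun i j => if σ i = j then (ε i : ℤ) else 0

/-- The homomorphism of tori with matrix `A`. -/
def torusLin {m n : ℕ} (A : Matrix (Fin n) (Fin m) ℤ) : C(Torus m, Torus n) :=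
  ⟨fun x i => ∑ j, A i j • x j, by fun_prop⟩

theorem torusLin_one {n : ℕ} (x : Torus n) : torusLin 1 x = x := by
  ext i
  simp [torusLin, Matrix.one_apply, ite_smul]

theorem torusLin_torusLin {l m n : ℕ} (A : Matrix (Fin n) (Fin m) ℤ) (B : Matrix (Fin m) (Fin l) ℤ)
    (x : Torus l) : torusLin A (torusLin B x) = torusLin (A * B) x := by
  ext i
  simp only [torusLin, ContinuousMap.coe_mk, Matrix.mul_apply, Finset.smul_sum, Finset.sum_smul,
    mul_smul]
  exact Finset.sum_comm

theorem h1Matrix_torusLin_add {m n : ℕ} (A : Matrix (Fin n) (Fin m) ℤ) (y : Torus n) :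
    h1Matrix (torusLin A + ContinuousMap.const _ y) = A := by
  obtain ⟨e, rfl⟩ := (isOpenQuotientMap_torusProj n).surjective y
  refine HasLift.h1Matrix_eq
    ⟨⟨fun x => (A.map (Int.cast : ℤ → ℝ)).mulVec x + e, by fun_prop⟩, fun x => ?_, fun x k => ?_⟩
  · ext i
    have : (((A.map (Int.cast : ℤ → ℝ)).mulVec x i : ℝ) : UnitAddCircle) =
        ∑ j, A i j • ((x j : ℝ) : UnitAddCircle) := by
      change ((∑ j, (A i j : ℝ) * x j : ℝ) : UnitAddCircle) = _
      refine (map_sum (QuotientAddGroup.mk' (AddSubgroup.zmultiples (1 : ℝ))) _ _).trans ?_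
      refine Finset.sum_congr rfl fun j _ => ?_
      rw [← zsmul_eq_mul]
      rfl
    simp [torusProj, torusLin, this]
  · simp [intVec_mulVec, Matrix.mulVec_add, add_right_comm]

namespace GraphManifold

variable {M : GraphManifold}

/-- The inverse of a trivialization, relative to the given one. -/
def BlockTrivialization.symm {v : M.V} (τ : M.BlockTrivialization v) : M.BlockTrivialization v :=
  ⟨τ.1.symm, fun p => by rw [← τ.2 (τ.1.symm p), τ.1.apply_symm_apply]⟩

/-- The map of the fiber over `p` given by a trivialization. -/
def BlockTrivialization.fiberMap {v : M.V} (τ : M.BlockTrivialization v) (p : M.Φ v) :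
    C(Torus 2, Torus 2) :=
  ⟨fun y => (τ.1 (p, y)).2, by fun_prop⟩

/-- The image of the zero section under a trivialization. -/
def BlockTrivialization.sectionMap {v : M.V} (τ : M.BlockTrivialization v) (i : Fin 2) :
    C(M.Φ v, UnitAddCircle) :=
  ⟨fun p => (τ.1 (p, 0)).2 i, by fun_prop⟩

/-- A path in the base gives a homotopy between the fiber maps over its end points. -/
theorem BlockTrivialization.h1Matrix_fiberMap_eq {v : M.V} (τ : M.BlockTrivialization v)
    (p q : M.Φ v) : h1Matrix (τ.fiberMap p) = h1Matrix (τ.fiberMap q) := by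
  have := (M.isBaseSurface v).pathConnectedSpace
  obtain ⟨γ⟩ := PathConnectedSpace.joined p q
  refine h1Matrix_eq_of_homotopic
    ⟨⟨⟨fun z => (τ.1 (γ z.1, z.2)).2, by fun_prop⟩, fun y => ?_, fun y => ?_⟩⟩
  · simp [BlockTrivialization.fiberMap]
  · simp [BlockTrivialization.fiberMap]

theorem BlockTrivialization.h1Matrix_fiberMap_mul_symm {v : M.V} (τ : M.BlockTrivialization v)
    (p : M.Φ v) : h1Matrix (τ.fiberMap p) * h1Matrix (τ.symm.fiberMap p) = 1 := by
  rw [← h1Matrix_comp, ← h1Matrix_id]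
  congr 1
  ext1 y
  have h1 : (p, (τ.symm.1 (p, y)).2) = τ.symm.1 (p, y) := Prod.ext (τ.symm.2 (p, y)).symm rfl
  change (τ.1 (p, (τ.symm.1 (p, y)).2)).2 = y
  rw [h1]
  change (τ.1 (τ.1.symm (p, y))).2 = y
  rw [τ.1.apply_symm_apply]

theorem degree_id : degree (ContinuousMap.id UnitAddCircle) = 1 :=
  HasDegree.degree_eq ⟨ContinuousMap.id ℝ, fun _ => rfl, by simp⟩

theorem degree_const (x : UnitAddCircle) : degree (ContinuousMap.const UnitAddCircle x) = 0 := by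
  obtain ⟨e, rfl⟩ := QuotientAddGroup.mk_surjective x
  exact HasDegree.degree_eq ⟨ContinuousMap.const ℝ e, fun _ => rfl, by simp⟩

/-- The top row is `(1, 0)` because a trivialization covers the identity of the base. The fiber
block can be read off at any point `p`, hence is shared by all boundary tori of the block. -/
theorem h1Matrix_torusTrivialization (w : M.W) (τ : M.BlockTrivialization (M.orig w))
    (p : M.Φ (M.orig w)) :
    h1Matrix (torusTrivialization w τ) =
      frame (fun i => degree ((τ.sectionMap i).comp (M.circle (M.orig w) ⟨w, rfl⟩)))
        (h1Matrix (τ.fiberMap p)) := by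
  rw [τ.h1Matrix_fiberMap_eq p (M.circle (M.orig w) ⟨w, rfl⟩ 0)]
  have hz : ∀ s : UnitAddCircle, (coordCircle (n := 3) 0 s) 0 = s := fun s => by
    simp [coordCircle]
  have hz' : ∀ s : UnitAddCircle, (fun l : Fin 2 => (coordCircle (n := 3) 0 s) l.succ) = 0 :=
    fun s => by ext l; simp [coordCircle, Fin.succ_ne_zero]
  have hs : ∀ (j : Fin 2) (s : UnitAddCircle), (coordCircle (n := 3) j.succ s) 0 = 0 :=
    fun j s => by simp [coordCircle, (Fin.succ_ne_zero _).symm]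
  have hs' : ∀ (j : Fin 2) (s : UnitAddCircle),
      (fun l : Fin 2 => (coordCircle (n := 3) j.succ s) l.succ) = coordCircle j s := fun j s => by
    ext l
    simp [coordCircle, Function.update_apply]
  ext i j
  refine Fin.cases ?_ (fun i => ?_) i <;> refine Fin.cases ?_ (fun j => ?_) j
  · rw [frame_zero_zero, ← degree_id]
    exact congrArg degree (ContinuousMap.ext fun s => hz s)
  · rw [frame_zero_succ, ← degree_const 0]
    exact congrArg degree (ContinuousMap.ext fun s => hs j s)
  · rw [frame_succ_zero]
    refine congrArg degree (ContinuousMap.ext fun s => ?_)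
    change (τ.1 (M.circle _ _ (coordCircle 0 s 0), fun l : Fin 2 => coordCircle 0 s l.succ)).2 i =
      (τ.1 (M.circle _ _ s, 0)).2 i
    rw [hz, hz']
  · rw [frame_succ_succ]
    refine congrArg degree (ContinuousMap.ext fun s => ?_)
    change (τ.1 (M.circle _ _ (coordCircle j.succ s 0),
      fun l : Fin 2 => coordCircle j.succ s l.succ)).2 i =
      (τ.1 (M.circle _ _ 0, coordCircle j s)).2 i
    rw [hs, hs']

/-- The trivialization that acts on the fibers by a matrix and moves the zero section to the
graph of a map. -/
def BlockTrivialization.ofMatrix {v : M.V} {A E : Matrix (Fin 2) (Fin 2) ℤ} (hAE : A * E = 1)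
    (hEA : E * A = 1) (X : C(M.Φ v, Torus 2)) : M.BlockTrivialization v :=
  ⟨{ toFun := fun p => (p.1, torusLin A p.2 + X p.1)
     invFun := fun p => (p.1, torusLin E (p.2 - X p.1))
     left_inv := fun p => by simp [torusLin_torusLin, hEA, torusLin_one]
     right_inv := fun p => by simp [torusLin_torusLin, hAE, torusLin_one]
     continuous_toFun := by fun_prop
     continuous_invFun := by fun_prop }, fun _ => rfl⟩

open Classical in
-- Fiberwise affine trivializations suffice; each coordinate of the translation part comes from
-- `IsBaseSurface.exists_degree_eq`.
theorem exists_blockTrivialization (v : M.V) {A E : Matrix (Fin 2) (Fin 2) ℤ} (hAE : A * E = 1)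
    (hEA : E * A = 1) (x : M.Star v → Fin 2 → ℤ) (hx : ∑ w, x w = 0) :
    ∃ τ : M.BlockTrivialization v, (∀ p, h1Matrix (τ.fiberMap p) = A) ∧
      ∀ i w, degree ((τ.sectionMap i).comp (M.circle v w)) = x w i := by
  choose X hX using fun i => (M.isBaseSurface v).exists_degree_eq (fun w => x w i) (by
    simpa using congrFun hx i)
  let Y : C(M.Φ v, Torus 2) := ⟨fun p i => X i p, by fun_prop⟩
  refine ⟨.ofMatrix hAE hEA Y, fun p => h1Matrix_torusLin_add A (Y p), fun i w => ?_⟩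
  rw [← hX]
  congr 2
  ext1 p
  simp [BlockTrivialization.sectionMap, BlockTrivialization.ofMatrix, torusLin, Y]

open Classical in
-- The matrix `frame (y w) (E v)` is the inverse of that of the trivialization: its columns are the
-- new basis of `H₁(T_w)` in the given coordinates. Shifts and degrees differ by a linear map
-- depending only on `v`, so the zero-sum condition carries over.
theorem isOrthogonal_iff : M.IsOrthogonal ↔
    ∃ (E : M.V → Matrix (Fin 2) (Fin 2) ℤ) (y : M.W → Fin 2 → ℤ),
      (∀ v, IsUnit (E v)) ∧ (∀ v, ∑ w : M.Star v, y w = 0) ∧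
      ∀ w, ∃ (σ : Equiv.Perm (Fin 3)) (ε : Fin 3 → ℤˣ), σ 0 ≠ 0 ∧
        M.g w * frame (y (M.rev w)) (E (M.orig (M.rev w))) =
          frame (y w) (E (M.orig w)) * signedPermMatrix σ ε := by
  have key : ∀ (w : M.W) (σ : Equiv.Perm (Fin 3)) (ε : Fin 3 → ℤˣ)
      (τ : ∀ v, M.BlockTrivialization v),
      ((torusTrivialization w (τ (M.orig w))).comp (M.glue w : C(Torus 3, Torus 3))).Homotopic
        ((signedPerm σ ε).comp (torusTrivialization (M.rev w) (τ (M.orig (M.rev w))))) ↔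
      h1Matrix (torusTrivialization w (τ (M.orig w))) * M.g w = signedPermMatrix σ ε *
        h1Matrix (torusTrivialization (M.rev w) (τ (M.orig (M.rev w)))) := fun w σ ε τ => by
    rw [g, signedPermMatrix, ← h1Matrix_signedPerm, ← h1Matrix_comp, ← h1Matrix_comp]
    exact ⟨h1Matrix_eq_of_homotopic, homotopic_of_h1Matrix_eq⟩
  constructor
  · rintro ⟨τ, hτ⟩
    have hne : ∀ v, Nonempty (M.Φ v) := fun v =>
      (M.isBaseSurface v).pathConnectedSpace.nonempty
    let p : ∀ v, M.Φ v := fun v => (hne v).some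
    let A : M.V → Matrix (Fin 2) (Fin 2) ℤ := fun v => h1Matrix ((τ v).fiberMap (p v))
    let E : M.V → Matrix (Fin 2) (Fin 2) ℤ := fun v => h1Matrix ((τ v).symm.fiberMap (p v))
    have hAE : ∀ v, A v * E v = 1 := fun v => (τ v).h1Matrix_fiberMap_mul_symm (p v)
    have hEA : ∀ v, E v * A v = 1 := fun v => mul_eq_one_comm.1 (hAE v)
    let x : ∀ v, M.Star v → Fin 2 → ℤ := fun v w i =>
      degree (((τ v).sectionMap i).comp (M.circle v w))
    refine ⟨E, fun w => -(E (M.orig w)).mulVec (x (M.orig w) ⟨w, rfl⟩),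
      fun v => ⟨⟨E v, A v, hEA v, hAE v⟩, rfl⟩, fun v => ?_, fun w => ?_⟩
    · have h1 : ∀ w : M.Star v, -(E (M.orig w)).mulVec (x (M.orig w) ⟨w, rfl⟩) =
          (-(E v).mulVecLin) (x v w) := by
        rintro ⟨w, rfl⟩
        rfl
      have h2 : ∑ w, x v w = 0 := by
        ext i
        simpa using (M.isBaseSurface v).sum_degree_eq_zero ((τ v).sectionMap i)
      rw [Finset.sum_congr rfl fun w _ => h1 w, ← map_sum, h2, map_zero]
    · obtain ⟨σ, ε, hσ, h⟩ := hτ w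
      refine ⟨σ, ε, hσ, ?_⟩
      rw [key, h1Matrix_torusTrivialization w _ (p _),
        h1Matrix_torusTrivialization (M.rev w) _ (p _)] at h
      have h1 := frame_neg_mul_frame (x := x (M.orig w) ⟨w, rfl⟩) (hEA (M.orig w))
      have h2 := frame_mul_frame_neg (x := x (M.orig (M.rev w)) ⟨M.rev w, rfl⟩)
        (hAE (M.orig (M.rev w)))
      calc _ = (frame _ (E (M.orig w)) * frame (x (M.orig w) ⟨w, rfl⟩) (A (M.orig w))) * M.g w *
            frame _ (E (M.orig (M.rev w))) := by rw [h1, one_mul]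
        _ = frame _ (E (M.orig w)) * (frame (x (M.orig w) ⟨w, rfl⟩) (A (M.orig w)) * M.g w) *
            frame _ (E (M.orig (M.rev w))) := by rw [mul_assoc (frame _ _)]
        _ = _ := by rw [h, mul_assoc, mul_assoc, h2, mul_one]
  · rintro ⟨E, y, hE, hy, hw⟩
    choose u hu using hE
    let A : M.V → Matrix (Fin 2) (Fin 2) ℤ := fun v => ↑(u v)⁻¹
    have hAE : ∀ v, A v * E v = 1 := fun v => by rw [← hu]; exact (u v).inv_mul
    have hEA : ∀ v, E v * A v = 1 := fun v => by rw [← hu]; exact (u v).mul_inv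
    choose τ hτA hτx using fun v => exists_blockTrivialization v (hAE v) (hEA v)
      (fun w => -(A v).mulVec (y w)) (by
        have : ∑ w : M.Star v, -(A v).mulVec (y w) = (-(A v).mulVecLin) (∑ w : M.Star v, y w) := by
          rw [map_sum]; rfl
        rw [this, hy, map_zero])
    have hframe : ∀ w, h1Matrix (torusTrivialization w (τ (M.orig w))) =
        frame (-(A (M.orig w)).mulVec (y w)) (A (M.orig w)) := fun w => by
      have hne := (M.isBaseSurface (M.orig w)).pathConnectedSpace.nonempty
      rw [h1Matrix_torusTrivialization w _ hne.some, hτA]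
      congr 1
      exact funext fun i => hτx _ i ⟨w, rfl⟩
    refine ⟨τ, fun w => ?_⟩
    obtain ⟨σ, ε, hσ, h⟩ := hw w
    refine ⟨σ, ε, hσ, ?_⟩
    rw [key, hframe, hframe]
    have h1 := frame_neg_mul_frame (x := y w) (hAE (M.orig w))
    have h2 := frame_mul_frame_neg (x := y (M.rev w)) (hEA (M.orig (M.rev w)))
    rw [← mul_one (frame (-(A (M.orig w)).mulVec (y w)) (A (M.orig w)) * M.g w), ← h2, mul_assoc,
      ← mul_assoc (M.g w), h, ← mul_assoc, ← mul_assoc, h1, one_mul]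

end GraphManifold

/-! ### Intersection lattices -/

theorem fiberIncl_eq_vecCons {R : Type} [CommRing R] (p : Fin 2 → R) :
    fiberIncl R p = Matrix.vecCons 0 p := by
  ext i
  fin_cases i <;> rfl

theorem mem_fiberLattice {x : Fin 3 → ℤ} : x ∈ fiberLattice ↔ x 0 = 0 := by
  constructor
  · rintro ⟨p, rfl⟩
    rfl
  · intro h
    refine ⟨fun i => x i.succ, ?_⟩
    ext i
    fin_cases i
    · exact h.symm
    · rfl
    · rfl

/-! ### Bases of the rank two lattice and rows dual to them -/

theorem sum_fin_two_eq {R : Type*} [AddCommMonoid R] (f : Fin 2 → R) (k : Fin 2) :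
    ∑ i, f i = f k + f (k + 1) := by
  rw [Fin.sum_univ_two]
  fin_cases k
  · rfl
  · exact add_comm _ _

theorem fin_two_eq_or (k l : Fin 2) : l = k ∨ l = k + 1 := by
  revert k l
  decide

theorem fin_two_add_one_ne (k : Fin 2) : k + 1 ≠ k := by
  revert k
  decide

/-- In `Fin 2` the index `k + 1` is the one different from `k`; this convention names the two basis
vectors throughout. -/
theorem eq_smul_col_add_smul_col {R : Type*} [CommRing R] (E : Matrix (Fin 2) (Fin 2) R)
    (c : Fin 2 → R) (k : Fin 2) :
    E.mulVec c = c k • E.col k + c (k + 1) • E.col (k + 1) := by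
  ext i
  simp only [Matrix.mulVec, dotProduct, Pi.add_apply, Pi.smul_apply, smul_eq_mul, Matrix.col_apply]
  rw [sum_fin_two_eq _ k, mul_comm, mul_comm (E i (k + 1))]

theorem exists_eq_smul_col_add_smul_col {R : Type*} [CommRing R] {E : Matrix (Fin 2) (Fin 2) R}
    (hE : IsUnit E) (k : Fin 2) (p : Fin 2 → R) :
    ∃ x y : R, p = x • E.col k + y • E.col (k + 1) := by
  obtain ⟨u, rfl⟩ := hE
  let c : Fin 2 → R := (↑u⁻¹ : Matrix (Fin 2) (Fin 2) R).mulVec p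
  refine ⟨c k, c (k + 1), ?_⟩
  rw [← eq_smul_col_add_smul_col, Matrix.mulVec_mulVec, u.mul_inv, Matrix.one_mulVec]

theorem col_linearIndependent {R : Type*} [CommRing R] {E : Matrix (Fin 2) (Fin 2) R}
    (hE : IsUnit E) (k : Fin 2) {x y : R} (h : x • E.col k + y • E.col (k + 1) = 0) :
    x = 0 ∧ y = 0 := by
  let c : Fin 2 → R := fun i => if i = k then x else y
  have h1 : E.mulVec c = 0 := by
    rw [eq_smul_col_add_smul_col E c k]
    simpa [c, fin_two_add_one_ne] using h
  obtain ⟨u, rfl⟩ := hE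
  have h2 : c = 0 := by
    rw [← Matrix.one_mulVec c, ← u.inv_mul, ← Matrix.mulVec_mulVec, h1, Matrix.mulVec_zero]
  exact ⟨by simpa [c] using congrFun h2 k,
    by simpa [c, fin_two_add_one_ne] using congrFun h2 (k + 1)⟩

theorem mul_eq_one_of_smul_smul {n : ℕ} {x : Fin n → ℤ} (hx : x ≠ 0) {m m' : ℤ}
    (h : (m * m') • x = x) : m * m' = 1 := by
  have : (m * m' - 1) • x = 0 := by rw [sub_smul, h, one_smul, sub_self]
  rcases smul_eq_zero.1 this with h1 | h1
  · linarith
  · exact absurd h1 hx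

theorem col_ne_zero {E : Matrix (Fin 2) (Fin 2) ℤ} (hE : IsUnit E) (k : Fin 2) : E.col k ≠ 0 := by
  intro h
  exact one_ne_zero (col_linearIndependent hE k (x := 1) (y := 0) (by rw [h]; simp)).1

/-- `b` vanishes on the `k`-th column of `E` and is `±1` on the other one. -/
def IsDualToCols (b : Fin 2 → ℤ) (E : Matrix (Fin 2) (Fin 2) ℤ) (k : Fin 2) : Prop :=
  b ⬝ᵥ E.col k = 0 ∧ IsUnit (b ⬝ᵥ E.col (k + 1))

theorem IsDualToCols.dotProduct_eq_zero_iff {b : Fin 2 → ℤ} {E : Matrix (Fin 2) (Fin 2) ℤ}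
    {k : Fin 2} (h : IsDualToCols b E k) (hE : IsUnit E) (p : Fin 2 → ℤ) :
    b ⬝ᵥ p = 0 ↔ p ∈ Submodule.span ℤ {E.col k} := by
  rw [Submodule.mem_span_singleton]
  constructor
  · intro hp
    obtain ⟨x, y, rfl⟩ := exists_eq_smul_col_add_smul_col hE k p
    rw [dotProduct_add, dotProduct_smul, dotProduct_smul, h.1, smul_zero, zero_add, smul_eq_mul,
      mul_eq_zero, or_iff_left h.2.ne_zero] at hp
    exact ⟨x, by simp [hp]⟩
  · rintro ⟨m, rfl⟩
    rw [dotProduct_smul, h.1, smul_zero]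

theorem IsDualToCols.gcd_eq_one {b : Fin 2 → ℤ} {E : Matrix (Fin 2) (Fin 2) ℤ}
    {k : Fin 2} (h : IsDualToCols b E k) : Int.gcd (b 0) (b 1) = 1 := by
  obtain ⟨u, hu⟩ := h.2
  rw [← Int.isCoprime_iff_gcd_eq_one]
  refine ⟨↑u⁻¹ * E.col (k + 1) 0, ↑u⁻¹ * E.col (k + 1) 1, ?_⟩
  rw [← u.inv_mul, hu]
  simp only [dotProduct, Fin.sum_univ_two]
  ring

/-- By Bézout `b` takes the value `1`. As it vanishes on one column, its value on the other one
divides `1`. -/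
theorem isDualToCols_of_gcd_eq_one {b : Fin 2 → ℤ} {E : Matrix (Fin 2) (Fin 2) ℤ} {k : Fin 2}
    (hE : IsUnit E) (hb : Int.gcd (b 0) (b 1) = 1) (h : b ⬝ᵥ E.col k = 0) :
    IsDualToCols b E k := by
  refine ⟨h, ?_⟩
  obtain ⟨x, y, hxy⟩ := Int.isCoprime_iff_gcd_eq_one.2 hb
  obtain ⟨s, t, hst⟩ := exists_eq_smul_col_add_smul_col hE k ![x, y]
  have h1 : b ⬝ᵥ ![x, y] = 1 := by
    rw [← hxy]
    simp [dotProduct, Fin.sum_univ_two, mul_comm]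
  rw [hst, dotProduct_add, dotProduct_smul, dotProduct_smul, h, smul_zero, zero_add,
    smul_eq_mul] at h1
  exact IsUnit.of_mul_eq_one _ (by rw [mul_comm]; exact h1)

theorem dotProduct_eq_zero_iff_of_gcd_eq_one {b : Fin 2 → ℤ} (hb : Int.gcd (b 0) (b 1) = 1)
    (p : Fin 2 → ℤ) : b ⬝ᵥ p = 0 ↔ p ∈ Submodule.span ℤ {![b 1, -b 0]} := by
  rw [Submodule.mem_span_singleton]
  obtain ⟨x, y, hxy⟩ := Int.isCoprime_iff_gcd_eq_one.2 hb
  simp only [dotProduct, Fin.sum_univ_two]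
  constructor
  · intro h
    -- Pairing `m • (b 1, -b 0)` with the Bézout coefficients in this way recovers `m`.
    refine ⟨y * p 0 - x * p 1, ?_⟩
    ext i
    fin_cases i
    · simp
      linear_combination p 0 * hxy - x * h
    · simp
      linear_combination p 1 * hxy - y * h
  · rintro ⟨m, rfl⟩
    simp
    ring

/-! ### Blocks of the gluing matrices and intersection lattices -/

namespace GraphManifold

variable (M : GraphManifold)

/-- The row `b_w` of the gluing matrix. -/
noncomputable def bRow (w : M.W) : Fin 2 → ℤ := fun j => M.g w 0 j.succ

/-- The block `d_w` of the gluing matrix. -/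
noncomputable def dBlock (w : M.W) : Matrix (Fin 2) (Fin 2) ℤ :=
  (M.g w).submatrix Fin.succ Fin.succ

theorem g_mul_g_rev (w : M.W) : M.g w * M.g (M.rev w) = 1 := by
  rw [g, g, ← h1Matrix_comp, M.glue_rev, ← h1Matrix_id]
  congr 1
  ext1 x
  exact (M.glue w).apply_symm_apply x

theorem g_rev_mul_g (w : M.W) : M.g (M.rev w) * M.g w = 1 :=
  mul_eq_one_comm.1 (M.g_mul_g_rev w)

theorem g_rev_mulVec_g_mulVec (w : M.W) (x : Fin 3 → ℤ) :
    (M.g (M.rev w)).mulVec ((M.g w).mulVec x) = x := by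
  rw [Matrix.mulVec_mulVec, g_rev_mul_g, Matrix.one_mulVec]

theorem g_mulVec_g_rev_mulVec (w : M.W) (x : Fin 3 → ℤ) :
    (M.g w).mulVec ((M.g (M.rev w)).mulVec x) = x := by
  rw [Matrix.mulVec_mulVec, g_mul_g_rev, Matrix.one_mulVec]

theorem g_mulVec_vecCons_zero (w : M.W) (p : Fin 2 → ℤ) :
    (M.g w).mulVec (Matrix.vecCons 0 p) =
      Matrix.vecCons (M.bRow w ⬝ᵥ p) ((M.dBlock w).mulVec p) := by
  ext i
  fin_cases i <;>
    simp [Matrix.mulVec, dotProduct, Fin.sum_univ_three, Fin.sum_univ_two, bRow, dBlock]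

/-- A vector of `F_w` lies in `F_{-w}` if and only if its `z_{-w}`-coordinate vanishes, and `b_{-w}`
computes this coordinate. -/
theorem mem_P (w : M.W) (p : Fin 2 → ℤ) : p ∈ M.P w ↔ M.bRow (M.rev w) ⬝ᵥ p = 0 := by
  have h0 : ((M.g (M.rev w)).mulVec (fiberIncl ℤ p)) 0 = M.bRow (M.rev w) ⬝ᵥ p := by
    rw [fiberIncl_eq_vecCons, g_mulVec_vecCons_zero]
    rfl
  rw [P, Submodule.mem_comap, Submodule.mem_inf, Submodule.mem_map, ← h0]
  constructor
  · rintro ⟨-, x, hx, h⟩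
    rw [← h, Matrix.mulVecLin_apply, g_rev_mulVec_g_mulVec]
    exact mem_fiberLattice.1 hx
  · intro h
    exact ⟨⟨p, rfl⟩, _, mem_fiberLattice.2 h, M.g_mulVec_g_rev_mulVec w _⟩

theorem mem_P_rev (w : M.W) (p : Fin 2 → ℤ) : p ∈ M.P (M.rev w) ↔ M.bRow w ⬝ᵥ p = 0 := by
  rw [mem_P, M.rev_rev]

theorem intersectionNumber_eq (w : M.W) :
    M.intersectionNumber w = Int.gcd (M.bRow w 0) (M.bRow w 1) := rfl

variable {M}

/-- The supremum is attained, as the sizes are bounded by the number of edges; a third lattice would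
raise it to `3`. -/
theorem exists_P_ne_of_type_eq_two {v : M.V} (h : M.type v = 2) :
    ∃ w₁ w₂, M.orig w₁ = v ∧ M.orig w₂ = v ∧ M.P w₁ ≠ M.P w₂ ∧
      ∀ w, M.orig w = v → M.P w = M.P w₁ ∨ M.P w = M.P w₂ := by
  classical
  set A : Set ℕ := {k | ∃ S : Finset M.W, S.card = k ∧ (∀ w ∈ S, M.orig w = v) ∧
    (S : Set M.W).Pairwise fun w w' => M.P w ≠ M.P w'} with hA
  have hbdd : BddAbove A := ⟨Fintype.card M.W, by
    rintro _ ⟨S, rfl, -⟩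
    exact S.card_le_univ⟩
  have hne : A.Nonempty := ⟨0, ∅, by simp⟩
  have hsup : sSup A = 2 := h
  obtain ⟨S, hS, hSv, hSP⟩ : 2 ∈ A := hsup ▸ Nat.sSup_mem hne hbdd
  obtain ⟨w₁, w₂, h12, rfl⟩ := Finset.card_eq_two.1 hS
  have hP : M.P w₁ ≠ M.P w₂ := hSP (by simp) (by simp) h12
  refine ⟨w₁, w₂, hSv _ (by simp), hSv _ (by simp), hP, fun w hw => ?_⟩
  by_contra! hcon
  have h1 : w ≠ w₁ := fun h => hcon.1 (h ▸ rfl)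
  have h2 : w ≠ w₂ := fun h => hcon.2 (h ▸ rfl)
  have h3 : 3 ∈ A := by
    refine ⟨{w, w₁, w₂}, Finset.card_eq_three.2 ⟨w, w₁, w₂, h1, h2, h12, rfl⟩, ?_, ?_⟩
    · intro x hx
      rcases Finset.mem_insert.1 hx with rfl | hx
      · exact hw
      · exact hSv x hx
    · intro x hx y hy hxy
      simp only [Finset.coe_insert, Finset.coe_singleton, Set.mem_insert_iff,
        Set.mem_singleton_iff] at hx hy
      rcases hx with rfl | rfl | rfl <;> rcases hy with rfl | rfl | rfl
      · exact absurd rfl hxy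
      · exact hcon.1
      · exact hcon.2
      · exact hcon.1.symm
      · exact absurd rfl hxy
      · exact hP
      · exact hcon.2.symm
      · exact hP.symm
      · exact absurd rfl hxy
  have := le_csSup hbdd h3
  omega

/-! ### The intersection orientation -/

theorem gReal_mulVec_fiberIncl_toReal (w : M.W) (p : Fin 2 → ℤ) :
    (M.gReal w).mulVec (fiberIncl ℝ (toReal p)) =
      Matrix.vecCons ((M.bRow w ⬝ᵥ p : ℤ) : ℝ) (toReal ((M.dBlock w).mulVec p)) := by
  rw [fiberIncl_eq_vecCons]
  ext i
  fin_cases i <;>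
    simp [Matrix.mulVec, dotProduct, Fin.sum_univ_three, Fin.sum_univ_two, bRow, dBlock, gReal,
      toReal]

theorem det_intersection_frame (w : M.W) (a b u' : Fin 2 → ℝ) :
    Matrix.det (Matrix.of ![fiberIncl ℝ a, (M.gReal w).mulVec (fiberIncl ℝ b), fiberIncl ℝ u']) =
      -(M.bRow w 0 * b 0 + M.bRow w 1 * b 1) * wedge a u' := by
  rw [Matrix.det_fin_three]
  simp [fiberIncl, Matrix.mulVec, dotProduct, Fin.sum_univ_three, gReal, bRow, wedge]
  ring

/-- The lattice is the kernel of the primitive row `b_w`, which leaves two generators. By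
`det_intersection_frame` the orientation condition says `b_w(b) < 0`, and `b ∧ u = 1` then selects
one of them. -/
theorem isIntersectionOrientation_iff {w : M.W} (hw : M.intersectionNumber w = 1)
    (u : Fin 2 → ℤ) :
    M.IsIntersectionOrientation w u ↔ u = ![M.bRow w 1, -M.bRow w 0] := by
  rw [intersectionNumber_eq] at hw
  set u₀ : Fin 2 → ℤ := ![M.bRow w 1, -M.bRow w 0] with hu₀
  have hP : M.P (M.rev w) = Submodule.span ℤ {u₀} := by
    ext p
    rw [mem_P_rev, dotProduct_eq_zero_iff_of_gcd_eq_one hw]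
  have hu₀0 : u₀ ≠ 0 := by
    intro h
    have h1 : M.bRow w 1 = 0 := by simpa [hu₀] using congrFun h 0
    have h2 : M.bRow w 0 = 0 := by simpa [hu₀] using congrFun h 1
    simp [h1, h2] at hw
  constructor
  · rintro ⟨hu, u', a, b, -, ha, hb, hdet⟩
    rw [det_intersection_frame, ha, mul_one] at hdet
    rw [hP] at hu
    obtain ⟨m, hm⟩ := Submodule.mem_span_singleton.1
      (show u ∈ Submodule.span ℤ {u₀} from hu ▸ Submodule.mem_span_singleton_self u)
    obtain ⟨m', hm'⟩ := Submodule.mem_span_singleton.1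
      (show u₀ ∈ Submodule.span ℤ {u} from hu ▸ Submodule.mem_span_singleton_self u₀)
    have h1 : m' * m = 1 := mul_eq_one_of_smul_smul hu₀0 (by rw [mul_smul, hm, hm'])
    rcases Int.eq_one_or_neg_one_of_mul_eq_one' h1 with ⟨-, h2⟩ | ⟨-, h2⟩
    · rw [← hm, h2, one_smul]
    · rw [← hm, h2] at hb
      simp [wedge, toReal, hu₀] at hb
      linarith
  · rintro rfl
    have h1 : (M.gReal w).mulVec (fiberIncl ℝ (toReal u₀)) =
        fiberIncl ℝ (toReal ((M.dBlock w).mulVec u₀)) := by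
      have h2 : M.bRow w ⬝ᵥ u₀ = 0 := by
        rw [dotProduct_eq_zero_iff_of_gcd_eq_one hw]
        exact Submodule.mem_span_singleton_self _
      rw [gReal_mulVec_fiberIncl_toReal, h2, fiberIncl_eq_vecCons, Int.cast_zero]
    set u' := (M.dBlock w).mulVec u₀ with hu'
    have hu'0 : u' ≠ 0 := by
      intro h
      have h2 : M.bRow w ⬝ᵥ u₀ = 0 := by
        rw [dotProduct_eq_zero_iff_of_gcd_eq_one hw]
        exact Submodule.mem_span_singleton_self _
      have h3 := M.g_rev_mulVec_g_mulVec w (Matrix.vecCons 0 u₀)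
      rw [g_mulVec_vecCons_zero, h2, ← hu', h] at h3
      have h4 : (Matrix.vecCons 0 0 : Fin 3 → ℤ) = 0 := by simp
      rw [h4, Matrix.mulVec_zero] at h3
      exact hu₀0 (funext fun i => (congrFun h3 i.succ).symm)
    have hpos : 0 < (u' 0 : ℝ) ^ 2 + (u' 1 : ℝ) ^ 2 := by
      by_contra! hle
      have h2 : (u' 0 : ℝ) = 0 := by nlinarith [sq_nonneg (u' 0 : ℝ), sq_nonneg (u' 1 : ℝ)]
      have h3 : (u' 1 : ℝ) = 0 := by nlinarith [sq_nonneg (u' 0 : ℝ), sq_nonneg (u' 1 : ℝ)]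
      refine hu'0 (funext fun i => ?_)
      fin_cases i
      · exact_mod_cast h2
      · exact_mod_cast h3
    obtain ⟨x, y, hxy⟩ := Int.isCoprime_iff_gcd_eq_one.2 hw
    have hxy' : (x : ℝ) * M.bRow w 0 + y * M.bRow w 1 = 1 := by exact_mod_cast hxy
    -- `a` is `u'` rotated by a right angle and divided by its squared length. The vector `b` below
    -- is minus the Bézout vector of `b_w`, so that `b_w(b) = -1`.
    have ha : wedge ![(u' 1 : ℝ) / ((u' 0 : ℝ) ^ 2 + (u' 1 : ℝ) ^ 2),
        -(u' 0 : ℝ) / ((u' 0 : ℝ) ^ 2 + (u' 1 : ℝ) ^ 2)] (toReal u') = 1 := by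
      simp [wedge, toReal]
      field_simp
      ring
    refine ⟨hP, toReal u', _, ![-(x : ℝ), -(y : ℝ)], h1, ha, ?_, ?_⟩
    · simp [wedge, toReal, hu₀]
      linarith
    · rw [det_intersection_frame, ha, mul_one]
      simp
      linarith

theorem wedge_interOrientation {w : M.W} (hw : M.intersectionNumber w = 1) (q : Fin 2 → ℝ) :
    wedge q (toReal (M.interOrientation w)) = -(M.bRow w 0 * q 0 + M.bRow w 1 * q 1) := by
  have h : M.interOrientation w = ![M.bRow w 1, -M.bRow w 0] :=
    (isIntersectionOrientation_iff hw _).1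
      (Classical.epsilon_spec ⟨_, (isIntersectionOrientation_iff hw _).2 rfl⟩)
  rw [h]
  simp [wedge, toReal]
  ring

/-- Wedging with the intersection orientation is `-b_w` for every edge, and the common sign is
absorbed into `α`. -/
theorem mem_Q_iff (h : ∀ w, M.intersectionNumber w = 1) (v : M.V) (q : M.Star v → Fin 2 → ℝ) :
    q ∈ M.Q v ↔ ∃ α : ℝ, ∀ w : M.Star v, M.bRow w 0 * q w 0 + M.bRow w 1 * q w 1 = α := by
  constructor
  · rintro ⟨α, hα⟩
    refine ⟨-α, fun w => ?_⟩
    rw [← hα w, wedge_interOrientation (h w), neg_neg]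
  · rintro ⟨α, hα⟩
    refine ⟨-α, fun w => ?_⟩
    rw [← hα w, wedge_interOrientation (h w)]

end GraphManifold

/-! ### Adapted bases of the fiber groups -/

namespace GraphManifold

variable {M : GraphManifold}

/-- Bases `E v` of the fiber groups such that, for every edge `w`, the `k w`-th basis vector at
the terminal vertex of `w` generates the intersection lattice and the row `b_w` is `±1` on the
other basis vector. -/
structure IsAdapted (E : M.V → Matrix (Fin 2) (Fin 2) ℤ) (k : M.W → Fin 2) : Prop where
  isUnit : ∀ v, IsUnit (E v)
  isDualToCols : ∀ w, IsDualToCols (M.bRow w) (E (M.orig (M.rev w))) (k w)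

/-- The basis vector at the terminal vertex of `w` that does not generate the intersection lattice
of `w`. -/
def otherVector (E : M.V → Matrix (Fin 2) (Fin 2) ℤ) (k : M.W → Fin 2) (w : M.W) : Fin 2 → ℤ :=
  (E (M.orig (M.rev w))).col (k w + 1)

/-- The value `±1` of the row `b_w` on `otherVector E k w`. -/
noncomputable def edgeSign (E : M.V → Matrix (Fin 2) (Fin 2) ℤ) (k : M.W → Fin 2) (w : M.W) : ℤ :=
  M.bRow w ⬝ᵥ otherVector E k w

/-- The vector `y_w` with `z_w + y_w = ± otherVector E k w` in `L_w`. -/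
noncomputable def edgeShift (E : M.V → Matrix (Fin 2) (Fin 2) ℤ) (k : M.W → Fin 2) (w : M.W) :
    Fin 2 → ℤ :=
  edgeSign E k w • (M.dBlock w).mulVec (otherVector E k w)

theorem D_toReal (w : M.W) (p : Fin 2 → ℤ) :
    M.D w (toReal p) = toReal ((M.dBlock w).mulVec p) := by
  ext i
  simp [D, gReal, dBlock, toReal, Matrix.mulVec, dotProduct]

theorem bRow_toReal (E : M.V → Matrix (Fin 2) (Fin 2) ℤ) (k : M.W → Fin 2) (w : M.W) (t : ℝ) :
    M.bRow w 0 * (t • toReal (otherVector E k w)) 0 +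
      M.bRow w 1 * (t • toReal (otherVector E k w)) 1 = t * edgeSign E k w := by
  simp [edgeSign, toReal, dotProduct, Fin.sum_univ_two]
  ring

open Classical in
theorem sum_D_smul (E : M.V → Matrix (Fin 2) (Fin 2) ℤ) (k : M.W → Fin 2) (v : M.V) (α : ℝ) :
    ∑ w : M.Star v, M.D w ((α * edgeSign E k w) • toReal (otherVector E k w)) =
      α • toReal (∑ w : M.Star v, edgeShift E k w) := by
  ext i
  fin_cases i <;> simp [D_toReal, edgeShift, toReal, Finset.mul_sum, mul_assoc]

namespace IsAdapted

variable {E : M.V → Matrix (Fin 2) (Fin 2) ℤ} {k : M.W → Fin 2}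

theorem intersectionNumber_eq_one (h : IsAdapted E k) (w : M.W) : M.intersectionNumber w = 1 :=
  (h.isDualToCols w).gcd_eq_one

theorem isUnit_edgeSign (h : IsAdapted E k) (w : M.W) : IsUnit (edgeSign E k w) := (h.isDualToCols w).2

theorem edgeSign_mul_self (h : IsAdapted E k) (w : M.W) : edgeSign E k w * edgeSign E k w = 1 :=
  Int.isUnit_mul_self (h.isUnit_edgeSign w)

theorem P_rev_eq (h : IsAdapted E k) (w : M.W) :
    M.P (M.rev w) = Submodule.span ℤ {(E (M.orig (M.rev w))).col (k w)} := by
  ext p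
  rw [mem_P_rev, (h.isDualToCols w).dotProduct_eq_zero_iff (h.isUnit _)]

theorem P_eq (h : IsAdapted E k) (w : M.W) : M.P w = Submodule.span ℤ {(E (M.orig w)).col (k (M.rev w))} := by
  have := h.P_rev_eq (M.rev w)
  rwa [M.rev_rev] at this

/-- Edges at `v` with different lattices use different columns of `E v`, so both columns lie in the
subgroup. -/
theorem fiberIntersections_eq_top (h : IsAdapted E k) {v : M.V} (hv : M.type v = 2) : M.fiberIntersections v = ⊤ := by
  obtain ⟨w₁, w₂, rfl, h2, hne, -⟩ := exists_P_ne_of_type_eq_two hv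
  have hk : k (M.rev w₂) = k (M.rev w₁) + 1 :=
    (fin_two_eq_or (k (M.rev w₁)) (k (M.rev w₂))).resolve_left fun hk =>
      hne (by rw [h.P_eq, h.P_eq w₂, hk, h2])
  have h1 : M.P w₁ ≤ M.fiberIntersections (M.orig w₁) :=
    le_iSup₂_of_le (f := fun w (_ : M.orig w = M.orig w₁) => M.P w) w₁ rfl le_rfl
  have h3 : M.P w₂ ≤ M.fiberIntersections (M.orig w₁) :=
    le_iSup₂_of_le (f := fun w (_ : M.orig w = M.orig w₁) => M.P w) w₂ h2 le_rfl
  rw [h.P_eq, Submodule.span_singleton_le_iff_mem] at h1 h3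
  rw [h2, hk] at h3
  rw [eq_top_iff]
  intro p _
  obtain ⟨x, y, rfl⟩ := exists_eq_smul_col_add_smul_col (h.isUnit (M.orig w₁)) (k (M.rev w₁)) p
  exact add_mem (Submodule.smul_mem _ _ h1) (Submodule.smul_mem _ _ h3)

theorem otherLattice_eq (h : IsAdapted E k) (hM : ∀ v, M.type v = 2) (w : M.W) :
    M.otherLattice w = Submodule.span ℤ {otherVector E k w} := by
  have hcol : ∀ w', M.orig w' = M.orig (M.rev w) → M.P w' ≠ M.P (M.rev w) →
      M.P w' = Submodule.span ℤ {otherVector E k w} := fun w' h1 h2 => by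
    have hk : k (M.rev w') = k w + 1 :=
      (fin_two_eq_or (k w) (k (M.rev w'))).resolve_left fun hk =>
        h2 (by rw [h.P_eq w', h.P_rev_eq, hk, h1])
    rw [h.P_eq w', hk, h1, otherVector]
  refine le_antisymm (iSup_le fun w' => iSup_le fun h1 => iSup_le fun h2 => (hcol w' h1 h2).le) ?_
  obtain ⟨w₁, w₂, h1, h2, hne, -⟩ := exists_P_ne_of_type_eq_two (hM (M.orig (M.rev w)))
  obtain ⟨w', h3, h4⟩ : ∃ w', M.orig w' = M.orig (M.rev w) ∧ M.P w' ≠ M.P (M.rev w) := by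
    by_cases h5 : M.P w₁ = M.P (M.rev w)
    · exact ⟨w₂, h2, fun h6 => hne (h5.trans h6.symm)⟩
    · exact ⟨w₁, h1, h5⟩
  rw [← hcol w' h3 h4]
  exact le_iSup_of_le w' (le_iSup_of_le h3 (le_iSup_of_le h4 le_rfl))

theorem J_eq (h : IsAdapted E k) (hM : ∀ v, M.type v = 2) (w : M.W) :
    M.J w = Submodule.span ℝ {toReal (otherVector E k w)} := by
  rw [J, h.otherLattice_eq hM]
  refine le_antisymm (Submodule.span_le.2 ?_) (Submodule.span_mono ?_)
  · rintro _ ⟨p, hp, rfl⟩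
    obtain ⟨m, rfl⟩ := Submodule.mem_span_singleton.1 hp
    refine Submodule.mem_span_singleton.2 ⟨(m : ℝ), ?_⟩
    ext i
    simp [toReal]
  · rw [Set.singleton_subset_iff]
    exact ⟨_, Submodule.mem_span_singleton_self _, rfl⟩

open Classical in
theorem K_apply (h : IsAdapted E k) {v : M.V} (q : M.Q v) : M.K v q = ∑ w : M.Star v, M.D w (q.1 w) := by
  simp [K, LinearMap.domRestrict_apply, h.intersectionNumber_eq_one]

open Classical in
-- Membership in the lines `J_{-w}` leaves one scalar per edge, and `Q_v` fixes it as `α` times the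
-- edge sign. `K_v` maps this family to `α` times the sum of the shifts.
theorem B_le_ker_K_iff (h : IsAdapted E k) (hM : ∀ v, M.type v = 2) (v : M.V) :
    M.B v ≤ LinearMap.ker (M.K v) ↔ ∑ w : M.Star v, edgeShift E k w = 0 := by
  have hsq : ∀ w, (edgeSign E k w : ℝ) * edgeSign E k w = 1 := fun w => by
    exact_mod_cast h.edgeSign_mul_self w
  constructor
  · intro hB
    -- The generator of `B_v`, with `α = 1` written out to match `sum_D_smul`.
    let q : M.Star v → Fin 2 → ℝ := fun w =>
      (1 * edgeSign E k w : ℝ) • toReal (otherVector E k w)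
    have hq : q ∈ M.Q v := (mem_Q_iff h.intersectionNumber_eq_one v q).2 ⟨1, fun w => by
      rw [bRow_toReal, one_mul, hsq]⟩
    have hqB : (⟨q, hq⟩ : M.Q v) ∈ M.B v := by
      rw [B, Submodule.mem_comap, Submodule.mem_pi]
      intro w _
      rw [h.J_eq hM]
      exact Submodule.mem_span_singleton.2 ⟨_, rfl⟩
    have h0 := LinearMap.mem_ker.1 (hB hqB)
    rw [h.K_apply, sum_D_smul, one_smul] at h0
    ext i
    have := congrFun h0 i
    simpa only [toReal, Pi.zero_apply, Int.cast_eq_zero] using this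
  · intro hs q hq
    rw [B, Submodule.mem_comap, Submodule.mem_pi] at hq
    have hJ : ∀ w : M.Star v, ∃ t : ℝ, t • toReal (otherVector E k w) = q.1 w := fun w => by
      have := hq w (Set.mem_univ _)
      rw [h.J_eq hM] at this
      exact Submodule.mem_span_singleton.1 this
    choose t ht using hJ
    obtain ⟨α, hα⟩ := (mem_Q_iff h.intersectionNumber_eq_one v q.1).1 q.2
    have hq' : ∀ w : M.Star v,
        q.1 w = (α * edgeSign E k w) • toReal (otherVector E k w) := fun w => by
      rw [← hα w, ← ht w, bRow_toReal, mul_assoc, hsq, mul_one]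
    rw [LinearMap.mem_ker, h.K_apply, Finset.sum_congr rfl fun w _ => by rw [hq' w],
      sum_D_smul, hs]
    ext i
    simp [toReal]

theorem g_mulVec_otherVector (h : IsAdapted E k) (w : M.W) :
    (M.g w).mulVec (Matrix.vecCons 0 (otherVector E k w)) =
      edgeSign E k w • Matrix.vecCons 1 (edgeShift E k w) := by
  rw [g_mulVec_vecCons_zero, Matrix.smul_cons, edgeShift, smul_smul, h.edgeSign_mul_self, one_smul,
    smul_eq_mul, mul_one]
  rfl

/-- Obtained from `g_mulVec_otherVector` for the opposite edge by applying `g_w`, the inverse of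
`g_{-w}`. -/
theorem g_mulVec_edgeShift (h : IsAdapted E k) (w : M.W) :
    (M.g w).mulVec (Matrix.vecCons 1 (edgeShift E k (M.rev w))) =
      edgeSign E k (M.rev w) • Matrix.vecCons 0 ((E (M.orig w)).col (k (M.rev w) + 1)) := by
  have h1 := congrArg (fun x => edgeSign E k (M.rev w) • (M.g w).mulVec x)
    (h.g_mulVec_otherVector (M.rev w))
  simp only [Matrix.mulVec_smul, g_mulVec_g_rev_mulVec, smul_smul, h.edgeSign_mul_self,
    one_smul] at h1
  rw [← h1, otherVector, M.rev_rev]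

theorem exists_g_mulVec_col_eq_smul (h : IsAdapted E k) (w : M.W) :
    ∃ m : ℤ, (M.g w).mulVec (Matrix.vecCons 0 ((E (M.orig (M.rev w))).col (k w))) =
      m • Matrix.vecCons 0 ((E (M.orig w)).col (k (M.rev w))) := by
  rw [g_mulVec_vecCons_zero, (h.isDualToCols w).1]
  set p := (M.dBlock w).mulVec ((E (M.orig (M.rev w))).col (k w)) with hp
  have h1 : p ∈ M.P w := by
    have h2 := M.g_rev_mulVec_g_mulVec w
      (Matrix.vecCons 0 ((E (M.orig (M.rev w))).col (k w)))
    rw [g_mulVec_vecCons_zero, (h.isDualToCols w).1, g_mulVec_vecCons_zero] at h2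
    rw [mem_P]
    exact congrFun h2 0
  rw [h.P_eq] at h1
  obtain ⟨m, hm⟩ := Submodule.mem_span_singleton.1 h1
  exact ⟨m, by rw [← hm, Matrix.smul_cons, smul_zero]⟩

/-- The factors for `w` and `-w` are mutually inverse because the gluing isomorphisms are. -/
theorem exists_g_mulVec_col_eq_unit_smul (h : IsAdapted E k) (w : M.W) :
    ∃ m : ℤˣ, (M.g w).mulVec (Matrix.vecCons 0 ((E (M.orig (M.rev w))).col (k w))) =
      (m : ℤ) • Matrix.vecCons 0 ((E (M.orig w)).col (k (M.rev w))) := by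
  obtain ⟨m, hm⟩ := h.exists_g_mulVec_col_eq_smul w
  obtain ⟨m', hm'⟩ := h.exists_g_mulVec_col_eq_smul (M.rev w)
  rw [M.rev_rev] at hm'
  have h1 := M.g_rev_mulVec_g_mulVec w (Matrix.vecCons 0 ((E (M.orig (M.rev w))).col (k w)))
  rw [hm, Matrix.mulVec_smul, hm', smul_smul] at h1
  have h2 : m * m' = 1 := by
    refine mul_eq_one_of_smul_smul (fun h0 => ?_) h1
    exact col_ne_zero (h.isUnit (M.orig (M.rev w))) (k w) (funext fun i => congrFun h0 i.succ)
  exact ⟨⟨m, m', h2, by rw [mul_comm, h2]⟩, hm⟩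

end IsAdapted

/-! ### Signed permutations between frames and the construction of adapted bases -/

theorem frame_col_zero (y : Fin 2 → ℤ) (E : Matrix (Fin 2) (Fin 2) ℤ) :
    (frame y E).col 0 = Matrix.vecCons 1 y := by
  ext i
  refine Fin.cases rfl (fun i => rfl) i

theorem frame_col_succ (y : Fin 2 → ℤ) (E : Matrix (Fin 2) (Fin 2) ℤ) (j : Fin 2) :
    (frame y E).col j.succ = Matrix.vecCons 0 (E.col j) := by
  ext i
  refine Fin.cases rfl (fun i => rfl) i

theorem mul_eq_mul_signedPermMatrix_iff (G N N' : Matrix (Fin 3) (Fin 3) ℤ)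
    (σ : Equiv.Perm (Fin 3)) (ε : Fin 3 → ℤˣ) :
    G * N' = N * signedPermMatrix σ ε ↔
      ∀ i, G.mulVec (N'.col (σ i)) = (ε i : ℤ) • N.col i := by
  have h1 : ∀ l i, (N * signedPermMatrix σ ε) l (σ i) = ε i * N l i := fun l i => by
    rw [Matrix.mul_apply, Finset.sum_eq_single i]
    · simp [signedPermMatrix, mul_comm]
    · intro j _ hj
      simp [signedPermMatrix, hj]
    · simp
  constructor
  · intro h i
    ext l
    have h2 := congrFun (congrFun h l) (σ i)
    rw [h1] at h2
    exact h2
  · intro h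
    ext l j
    obtain ⟨i, rfl⟩ := σ.surjective j
    rw [h1]
    exact congrFun (h i) l

/-- With `a` and `b` the indices of the intersection vectors in `F_w` and `F_{-w}`, this permutation
matches these vectors and exchanges each boundary direction with the complementary fiber vector of
the other side. -/
theorem exists_perm_fin_three (a b : Fin 2) : ∃ σ : Equiv.Perm (Fin 3),
    σ 0 = (b + 1).succ ∧ σ (a + 1).succ = 0 ∧ σ a.succ = b.succ := by
  revert a b
  decide

open Classical in
theorem isOrthogonal_of_isAdapted {E : M.V → Matrix (Fin 2) (Fin 2) ℤ} {k : M.W → Fin 2}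
    (h : IsAdapted E k) (hs : ∀ v, ∑ w : M.Star v, edgeShift E k w = 0) : M.IsOrthogonal := by
  refine isOrthogonal_iff.2 ⟨E, edgeShift E k, h.isUnit, hs, fun w => ?_⟩
  obtain ⟨σ, h0, h1, h2⟩ := exists_perm_fin_three (k (M.rev w)) (k w)
  obtain ⟨m, hm⟩ := h.exists_g_mulVec_col_eq_unit_smul w
  obtain ⟨s, hs⟩ := h.isUnit_edgeSign w
  obtain ⟨s', hs'⟩ := h.isUnit_edgeSign (M.rev w)
  refine ⟨σ, Fin.cons s fun i => if i = k (M.rev w) then m else s', ?_, ?_⟩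
  · rw [h0]
    exact Fin.succ_ne_zero _
  · rw [mul_eq_mul_signedPermMatrix_iff]
    refine Fin.cases ?_ fun i => ?_
    · rw [h0, frame_col_succ, frame_col_zero, Fin.cons_zero, hs]
      exact h.g_mulVec_otherVector w
    · rcases fin_two_eq_or (k (M.rev w)) i with rfl | rfl
      · rw [h2, frame_col_succ, frame_col_succ, Fin.cons_succ, if_pos rfl]
        exact hm
      · rw [h1, frame_col_zero, frame_col_succ, Fin.cons_succ, if_neg (fin_two_add_one_ne _), hs']
        exact h.g_mulVec_edgeShift w

open Classical in
-- Since `σ 0 ≠ 0`, `±(z_w + y_w)` is the image of a column `l` of the basis of `F_{-w}`. This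
-- determines `y_w` as the shift. The other column goes to a fiber vector, so it is killed by `b_w`.
theorem IsOrthogonal.exists_isAdapted (h : M.IsOrthogonal) :
    ∃ (E : M.V → Matrix (Fin 2) (Fin 2) ℤ) (k : M.W → Fin 2), IsAdapted E k ∧
      ∀ v, ∑ w : M.Star v, edgeShift E k w = 0 := by
  obtain ⟨E, y, hE, hy, hw⟩ := isOrthogonal_iff.1 h
  have key : ∀ w, ∃ k : Fin 2, IsDualToCols (M.bRow w) (E (M.orig (M.rev w))) k ∧
      (M.bRow w ⬝ᵥ (E (M.orig (M.rev w))).col (k + 1)) •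
        (M.dBlock w).mulVec ((E (M.orig (M.rev w))).col (k + 1)) = y w := fun w => by
    obtain ⟨σ, ε, hσ, hg⟩ := hw w
    rw [mul_eq_mul_signedPermMatrix_iff] at hg
    obtain ⟨l, hl⟩ := Fin.exists_succ_eq.2 hσ
    have hl' : l + 1 + 1 = l := by
      clear hl
      revert l
      decide
    have h0 := hg 0
    rw [← hl, frame_col_succ, frame_col_zero, g_mulVec_vecCons_zero] at h0
    have hb : M.bRow w ⬝ᵥ (E (M.orig (M.rev w))).col l = ε 0 := by
      simpa using congrFun h0 0
    have hd : (M.dBlock w).mulVec ((E (M.orig (M.rev w))).col l) = (ε 0 : ℤ) • y w :=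
      funext fun i => congrFun h0 i.succ
    obtain ⟨i, hi⟩ := σ.surjective (l + 1).succ
    have hi0 : i ≠ 0 := by
      rintro rfl
      rw [← hl] at hi
      exact fin_two_add_one_ne l (Fin.succ_injective _ hi).symm
    obtain ⟨j, rfl⟩ := Fin.exists_succ_eq.2 hi0
    have h1 := hg j.succ
    rw [hi, frame_col_succ, frame_col_succ, g_mulVec_vecCons_zero] at h1
    refine ⟨l + 1, ⟨by simpa using congrFun h1 0, ?_⟩, ?_⟩
    · rw [hl', hb]
      exact (ε 0).isUnit
    · rw [hl', hb, hd, smul_smul, Int.units_coe_mul_self, one_smul]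
  choose k hk hky using key
  refine ⟨E, k, ⟨hE, hk⟩, fun v => ?_⟩
  rw [← hy v]
  exact Finset.sum_congr rfl fun w _ => hky w

/-- By (1) the intersection lattices are kernels of primitive rows, hence cyclic. By (2) generators
of the two lattices at `v` span `F_v`, so they are the columns of an invertible matrix. -/
theorem exists_isAdapted (hM : ∀ v, M.type v = 2) (h1 : ∀ w, M.intersectionNumber w = 1)
    (h2 : ∀ v, M.secondaryIntersectionNumber v = 1) :
    ∃ (E : M.V → Matrix (Fin 2) (Fin 2) ℤ) (k : M.W → Fin 2), IsAdapted E k := by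
  have hgen : ∀ w, ∃ u, M.P w = Submodule.span ℤ {u} := fun w =>
    ⟨_, Submodule.ext fun p => (M.mem_P w p).trans
      (dotProduct_eq_zero_iff_of_gcd_eq_one (b := M.bRow (M.rev w)) (h1 (M.rev w)) p)⟩
  have hE : ∀ v, ∃ E : Matrix (Fin 2) (Fin 2) ℤ, IsUnit E ∧
      ∀ w, M.orig w = v → ∃ k, M.P w = Submodule.span ℤ {E.col k} := fun v => by
    obtain ⟨w₁, w₂, hw₁, hw₂, -, hall⟩ := exists_P_ne_of_type_eq_two (hM v)
    obtain ⟨u₁, hu₁⟩ := hgen w₁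
    obtain ⟨u₂, hu₂⟩ := hgen w₂
    have htop : Submodule.span ℤ {u₁, u₂} = ⊤ := by
      have h3 : M.fiberIntersections v = ⊤ := by
        have := AddSubgroup.index_eq_one.1 (h2 v)
        rwa [← Submodule.toAddSubgroup_inj]
      rw [eq_top_iff, ← h3, Submodule.span_insert, ← hu₁, ← hu₂]
      refine iSup₂_le fun w hw => ?_
      rcases hall w hw with h | h
      · rw [h]; exact le_sup_left
      · rw [h]; exact le_sup_right
    let E : Matrix (Fin 2) (Fin 2) ℤ := Matrix.of fun i j => if j = 0 then u₁ i else u₂ i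
    have hc0 : E.col 0 = u₁ := by ext i; simp [E]
    have hc1 : E.col 1 = u₂ := by ext i; simp [E]
    have hsurj : ∀ p : Fin 2 → ℤ, ∃ c, E.mulVec c = p := fun p => by
      obtain ⟨x, y, hxy⟩ := Submodule.mem_span_pair.1
        (show p ∈ Submodule.span ℤ {u₁, u₂} from htop ▸ Submodule.mem_top)
      refine ⟨![x, y], ?_⟩
      rw [eq_smul_col_add_smul_col E _ 0, ← hxy, ← hc0, ← hc1]
      rfl
    refine ⟨E, ?_, fun w hw => ?_⟩
    · exact Matrix.mulVec_surjective_iff_isUnit.1 hsurj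
    · rcases hall w hw with h | h
      · exact ⟨0, by rw [h, hu₁, hc0]⟩
      · exact ⟨1, by rw [h, hu₂, hc1]⟩
  choose E hEu hEk using hE
  choose k hk using fun w => hEk _ (M.rev w) rfl
  refine ⟨E, k, hEu, fun w => isDualToCols_of_gcd_eq_one (hEu _) (h1 w) ?_⟩
  rw [← mem_P_rev, hk]
  exact Submodule.mem_span_singleton_self _

end GraphManifold

theorem theorem2 (M : GraphManifold) (hM : ∀ v : M.V, M.type v = 2) :
    M.IsOrthogonal ↔
      (∀ w : M.W, M.intersectionNumber w = 1) ∧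
      (∀ v : M.V, M.secondaryIntersectionNumber v = 1) ∧
      (∀ v : M.V, M.B v ≤ LinearMap.ker (M.K v)) := by
  constructor
  · intro h
    obtain ⟨E, k, hEk, hs⟩ := h.exists_isAdapted
    refine ⟨hEk.intersectionNumber_eq_one, fun v => ?_, fun v =>
      (hEk.B_le_ker_K_iff hM v).2 (hs v)⟩
    rw [GraphManifold.secondaryIntersectionNumber, hEk.fiberIntersections_eq_top (hM v)]
    simp
  · rintro ⟨h1, h2, h3⟩
    obtain ⟨E, k, hEk⟩ := GraphManifold.exists_isAdapted hM h1 h2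
    exact GraphManifold.isOrthogonal_of_isAdapted hEk fun v =>
      (hEk.B_le_ker_K_iff hM v).1 (h3 v)
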